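/- **Setting.** Let $\zeta=e^{2\pi i/10}$ and $\varphi=(1+\sqrt5)/2$; colours and indices $1,\dots,5$ are taken cyclically mod $5$. Let $H^5$ be the hypercube graph on $\{0,1\}^5$; an edge has colour $j$ if its ends differ in coordinate $j$, and the rainbow is $(1,2,3,4,5)$. A *height* is a function $h:\{0,1\}^5\to\mathbb Z_{\ge0}$ with $|h(v)-h(v')|=1$ for adjacent $v,v'$. For a vertex $v$ and a colour $j$, let $f_{j,j+1}(v)$ denote the center of the 4-cycle through $v$ with edge colours $j,j+1$. *Morse divisor.* $D_h=\sum_P\kappa_P P$ is the following formal sum of vertices and face centers. For a vertex $v$ with neighbours $v_1,\dots,v_5$ (along colours $1,\dots,5$), $\kappa_v=\lambda_v/2-1$, where $\lambda_v$ is the number of sign changes in the cyclic sequence $h(v_1)-h(v),\dots,h(v_5)-h(v)$. For a face center $f$ of a 4-cycle on which $h$ takes exactly two values, $\kappa_f=\lambda_f/2-1$ $(=1)$, where $\lambda_f$ is the number of sign changes around the cycle of $h$ minus its average on the cycle; for all other face centers $\kappa_f=0$. *Curve.* Let $X\subset\mathbb P^4(\mathbb C)$ be given by $x_1^2+x_2^2+x_3^2=\varphi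 x_1^2+x_2^2+x_4^2=(1+\varphi)x_1^2+x_2^2+x_5^2=0$, let $\pi:X\to\mathbb P^1$, $[x_1:\dots:x_5]\mapsto[x_1^2:x_2^2]$, and write $[1:y]$ as $y$. Put $\eta(z)=\frac{z-\zeta}{z-\zeta^{-1}}\cdot\frac{\zeta^3-\zeta^{-1}}{\zeta-\zeta^3}$. Embed $H^5$ in $X$ as follows: $(1,1,1,1,1)$ goes to $w_0=[1:\zeta^2\sqrt\varphi:\zeta^9:i\zeta^6:\zeta^8\sqrt\varphi]$; vertices at even (odd) distance from it go to points over $\eta(\infty)$ (over $\eta(0)$); the edges of colour $j$ are the components of the preimage under $\pi$ of the arc $\{\eta(t\zeta^{2j}):0\le t\le\infty\}$; the faces with colours $j,j+1$ are the components of the preimage under $\pi$ of the image under $\eta$ of the closed sector between the rays through $\zeta^{2j}$ and $\zeta^{2j+2}$, and $f_{j,j+1}(v)$ is the point over $\eta(\zeta^{2j+1})$ in the face with corner $v$. *Elliptic curves.* Let $E_1,E_4: y^2=x(x-1)(x-\varphi-1)$, $E_2,E_5: y^2=x(x-1)(x-\varphi)$, $E_3: y^2=x(x-1)(x+\varphi)$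 over $\mathbb C$, and let $\nu_k:X\to E_k$ be the maps $$\nu_1=\Big(-(2\varphi+1)\tfrac{x_1^2}{x_5^2}-\varphi,\ (2\varphi+1)\tfrac{x_2x_3x_4}{x_5^3}\Big),\quad \nu_2=\Big(\tfrac{x_2^2}{x_1^2}+\varphi+1,\ i\tfrac{x_3x_4x_5}{x_1^3}\Big),$$ $$\nu_3=\Big((2\varphi+1)\tfrac{x_3^2}{x_2^2}+\varphi+1,\ i(2\varphi+1)\tfrac{x_1x_4x_5}{x_2^3}\Big),\quad \nu_4=\Big((\varphi+1)\tfrac{x_4^2}{x_3^2}-\varphi,\ i\varphi\tfrac{x_1x_2x_5}{x_3^3}\Big),$$ $$\nu_5=\Big(-\tfrac{x_5^2}{x_4^2}+\varphi+1,\ i\tfrac{x_1x_2x_3}{x_4^3}\Big),$$ with value $O$ where the denominator vanishes, extended additively to divisors, $\nu_k(\sum\kappa_PP)=\sum\kappa_P\,\nu_k(P)\in E_k(\mathbb C)$. Put $$e^k_\infty=\nu_k(w_0),\qquad e^k_4=\nu_k\big(f_{k-2,k-1}(1,1,1,1,1)\big),\qquad e^k_2=\nu_k\big(f_{k,k+1}(1,1,1,1,1)\big).$$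 **Theorem.** Let $h$ be a height on $H^5$ and let $k\in\{1,\dots,5\}$. Then $\nu_k(D_h)$ is of the form $a\,e^k_\infty+b\,e^k_4+c\,e^k_2$ with $a,b,c\in\mathbb Z$, and whenever $a,b,c\in\mathbb Z$ satisfy $$\nu_k(D_h)=a\,e^k_\infty+b\,e^k_4+c\,e^k_2,$$ one has $|a|\le 8$, $b\equiv-a\pmod 4$, and $c\equiv0\pmod 2$ (that is, $c=0$ as a coefficient of the point $e^k_2$ of order 2). -/

import Mathlib

noncomputable section

namespace Adinkra

open Complex

/-! ### The hypercube `H⁵`, its heights and their discrete Morse divisors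

Colours and homogeneous coordinates are indexed cyclically by `Fin 5 = {1, 2, 3, 4, 5}`, where
`5` and `0` are the same element. The rainbow is `(1, 2, 3, 4, 5)`. -/

/-- Vertices of `H⁵`: the elements of `{0,1}⁵`. -/
abbrev Vertex : Type := Fin 5 → ZMod 2

/-- The neighbour of `v` along the edge of colour `j`. -/
def nbr (v : Vertex) (j : Fin 5) : Vertex := v + Pi.single j 1

/-- Height functions: nonnegative integers, changing by exactly one along every edge. -/
def IsHeight (h : Vertex → ℕ) : Prop :=
  ∀ v j, |(h (nbr v j) : ℤ) - (h v : ℤ)| = 1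

/-- The 4-cycles with edge colours `j, j+1`, each represented by the pair `(j, v)` in which `v` is
its corner with vanishing coordinates `j` and `j+1`. -/
abbrev Face : Type := {p : Fin 5 × Vertex // p.2 p.1 = 0 ∧ p.2 (p.1 + 1) = 0}

/-- The corners, in cyclic order, of the `(j, j+1)`-coloured 4-cycle through `v`. -/
def corner (j : Fin 5) (v : Vertex) : Fin 4 → Vertex :=
  ![v, nbr v j, nbr (nbr v j) (j + 1), nbr v (j + 1)]

/-- The number of sign changes around a cyclically ordered family of nonzero numbers. -/
def signChanges {n : ℕ} [NeZero n] (s : Fin n → ℚ) : ℕ :=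
  (Finset.univ.filter fun i => s i * s (i + 1) < 0).card

/-- The coefficient of a mesh vertex whose neighbours, in cyclic order, have relative heights `s`:
`-1` for an extremum (no sign change), `0` for a regular point (two sign changes), and `μ` for a
saddle point with `2 + 2 μ` sign changes. (The number of sign changes is always even.) -/
def morseCoeff {n : ℕ} [NeZero n] (s : Fin n → ℚ) : ℤ :=
  (signChanges s : ℤ) / 2 - 1

/-- The coefficient of a vertex of `H⁵`: its neighbours are taken in rainbow order. -/
def vertexCoeff (h : Vertex → ℕ) (v : Vertex) : ℤ :=
  morseCoeff fun j : Fin 5 => (h (nbr v j) : ℚ) - (h v : ℚ)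

/-- A 4-cycle is a bow tie if the height takes exactly two values on it (otherwise it is a diamond,
and the height takes three values). -/
def IsBowTie (h : Vertex → ℕ) (j : Fin 5) (v : Vertex) : Prop :=
  (Finset.univ.image fun i => h (corner j v i)).card = 2

/-- The height of a face center: the average of the heights of the corners. -/
def centerHeight (h : Vertex → ℕ) (j : Fin 5) (v : Vertex) : ℚ :=
  (∑ i, (h (corner j v i) : ℚ)) / 4

open Classical in
/-- The coefficient of a face center. The center is a vertex of the mesh, adjacent to the four
corners, exactly when the 4-cycle is a bow tie. -/
def faceCoeff (h : Vertex → ℕ) (j : Fin 5) (v : Vertex) : ℤ :=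
  if IsBowTie h j v then
    morseCoeff fun i : Fin 4 => (h (corner j v i) : ℚ) - centerHeight h j v
  else 0

/-- The discrete Morse divisor `D_h`, a formal sum of vertices and face centers of `H⁵`. -/
def morseDivisor (h : Vertex → ℕ) : (Vertex ⊕ Face) →₀ ℤ :=
  Finsupp.equivFunOnFinite.symm
    (Sum.elim (vertexCoeff h) fun f : Face => faceCoeff h f.1.1 f.1.2)

/-! ### The curve `X` and its map to the Riemann sphere -/

/-- `ζ = exp(2πi/10)`. -/
def zeta : ℂ := exp (2 * Real.pi * I / 10)

/-- The golden ratio, as a complex number. -/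
def phi : ℂ := (Real.goldenRatio : ℂ)

/-- `√φ`. -/
def sqrtPhi : ℂ := (Real.sqrt Real.goldenRatio : ℂ)

/-- The generalized Fermat curve `X ⊆ ℙ⁴`, given by its nonzero vectors of homogeneous
coordinates. -/
def X : Set (Fin 5 → ℂ) :=
  {x | x ≠ 0 ∧ x 1 ^ 2 + x 2 ^ 2 + x 3 ^ 2 = 0 ∧
    phi * x 1 ^ 2 + x 2 ^ 2 + x 4 ^ 2 = 0 ∧
    (1 + phi) * x 1 ^ 2 + x 2 ^ 2 + x 5 ^ 2 = 0}

/-- For `z = u / v` on the Riemann sphere and the Möbius transformation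
`η(z) = (z - ζ) / (z - ζ⁻¹) * (ζ³ - ζ⁻¹) / (ζ - ζ³)`, the point `π(x) = [x₁² : x₂²]` is
`[1 : η(z)]`. -/
def LiesOver (x : Fin 5 → ℂ) (u v : ℂ) : Prop :=
  x 1 ^ 2 * ((u - zeta * v) * (zeta ^ 3 - zeta⁻¹)) =
    x 2 ^ 2 * ((u - zeta⁻¹ * v) * (zeta - zeta ^ 3))

/-- The preimage in `X` of the path from `η(0)` to `η(∞)` of colour `j`, that is, of the image
under `η` of `{t ζ^(2j) | t ∈ [0, ∞]}`; here `t = r / s`. The edges of colour `j` are its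
components. -/
def edgePreimage (j : Fin 5) : Set (Fin 5 → ℂ) :=
  {x | x ∈ X ∧ ∃ r s : ℝ, 0 ≤ r ∧ 0 ≤ s ∧ (r ≠ 0 ∨ s ≠ 0) ∧
    LiesOver x (r * zeta ^ (2 * (j : ℕ))) s}

/-- The preimage in `X` of the image under `η` of the closed sector of the Riemann sphere between
the rays through `ζ^(2j)` and `ζ^(2j+2)`. The `(j, j+1)`-coloured faces are its components. -/
def facePreimage (j : Fin 5) : Set (Fin 5 → ℂ) :=
  {x | x ∈ X ∧ ∃ r r' s : ℝ, 0 ≤ r ∧ 0 ≤ r' ∧ 0 ≤ s ∧ (r ≠ 0 ∨ r' ≠ 0 ∨ s ≠ 0) ∧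
    LiesOver x (r * zeta ^ (2 * (j : ℕ)) + r' * zeta ^ (2 * (j : ℕ) + 2)) s}

/-- Homogeneous coordinates of the base point
`w₀ = [1 : √α∞ : √(-1 - α∞) : √(-φ - α∞) : √(-φ - 1 - α∞)]` with `α∞ = η(∞)`. -/
def baseCoord : Fin 5 → ℂ
  | 0 => zeta ^ 8 * sqrtPhi -- the coordinate `x 5`
  | 1 => 1
  | 2 => zeta ^ 2 * sqrtPhi
  | 3 => zeta ^ 9
  | 4 => I * zeta ^ 6

/-- The embedding of `H⁵` in `X` that sends `(1,1,1,1,1)` to `w₀`: white vertices (those at even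
distance from `(1,1,1,1,1)`) lie over `η(∞)`, black ones over `η(0)`; vertices adjacent along
colour `j` are the ends of an edge of colour `j` in `X`; and `faceCenter j v`, that is
`f_{j,j+1}(v)`, is the point over `η(ζ^(2j+1))` in the `(j, j+1)`-coloured face of `X` with corner
`v`. Up to the choice of homogeneous coordinates, this determines all the points. -/
structure Embedding where
  vertex : Vertex → X
  faceCenter : Fin 5 → Vertex → X
  vertex_base : (vertex 1 : Fin 5 → ℂ) = baseCoord
  vertex_white : ∀ v, ∑ i, v i = 1 → LiesOver (vertex v) 1 0
  vertex_black : ∀ v, ∑ i, v i = 0 → LiesOver (vertex v) 0 1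
  vertex_edge : ∀ v j, JoinedIn (edgePreimage j) (vertex v : Fin 5 → ℂ) (vertex (nbr v j))
  faceCenter_over : ∀ j v, LiesOver (faceCenter j v) (zeta ^ (2 * (j : ℕ) + 1)) 1
  faceCenter_face : ∀ j v, JoinedIn (facePreimage j) (vertex v : Fin 5 → ℂ) (faceCenter j v)

/-! ### Construction of the embedding in coordinates -/

theorem phi_sq : phi ^ 2 = phi + 1 := by
  unfold phi
  exact_mod_cast Real.goldenRatio_sq

theorem phi_ne_zero : phi ≠ 0 := by
  unfold phi
  exact_mod_cast Real.goldenRatio_pos.ne'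

theorem phi_sub_one_ne_zero : phi - 1 ≠ 0 := by
  intro h
  have h1 := phi_sq
  rw [sub_eq_zero.mp h] at h1
  norm_num at h1

theorem phi_add_one_ne_zero : phi + 1 ≠ 0 := by
  rw [← phi_sq]
  exact pow_ne_zero _ phi_ne_zero

theorem zeta_eq : zeta = exp (((Real.pi / 5 : ℝ) : ℂ) * I) := by
  unfold zeta
  congr 1
  push_cast
  ring

theorem zeta_pow_eq (n : ℕ) : zeta ^ n = exp (((n * (Real.pi / 5) : ℝ) : ℂ) * I) := by
  rw [zeta_eq, ← Complex.exp_nat_mul]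
  congr 1
  push_cast
  ring

theorem zeta_pow_re (n : ℕ) : (zeta ^ n).re = Real.cos (n * (Real.pi / 5)) := by
  rw [zeta_pow_eq, Complex.exp_ofReal_mul_I_re]

theorem zeta_pow_im (n : ℕ) : (zeta ^ n).im = Real.sin (n * (Real.pi / 5)) := by
  rw [zeta_pow_eq, Complex.exp_ofReal_mul_I_im]

theorem zeta_ne_zero : zeta ≠ 0 := Complex.exp_ne_zero _

theorem zeta_five : zeta ^ 5 = -1 := by
  rw [zeta_pow_eq, show ((5 : ℕ) * (Real.pi / 5) : ℝ) = Real.pi by push_cast; ring,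
    Complex.exp_pi_mul_I]

theorem zeta_inv : zeta⁻¹ = -zeta ^ 4 := by
  refine inv_eq_of_mul_eq_one_left ?_
  linear_combination -zeta_five

theorem zeta_conj : (starRingEnd ℂ) zeta = -zeta ^ 4 := by
  rw [← zeta_inv, zeta_eq, ← Complex.exp_neg, ← Complex.exp_conj, map_mul,
    Complex.conj_ofReal, Complex.conj_I, mul_neg]

theorem phi_eq : phi = zeta - zeta ^ 4 := by
  have h : zeta - zeta ^ 4 = zeta + (starRingEnd ℂ) zeta := by rw [zeta_conj]; ring
  rw [h, Complex.add_conj, ← pow_one zeta, zeta_pow_re]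
  unfold phi
  rw [Nat.cast_one, one_mul, Real.cos_pi_div_five]
  unfold Real.goldenRatio
  push_cast
  ring

theorem zeta_min : zeta ^ 4 - zeta ^ 3 + zeta ^ 2 - zeta + 1 = 0 := by
  have h1 : zeta + 1 ≠ 0 := by
    intro h
    have := zeta_pow_im 1
    rw [pow_one, eq_neg_of_add_eq_zero_left h] at this
    have h2 : 0 < Real.sin ((1 : ℕ) * (Real.pi / 5)) :=
      Real.sin_pos_of_pos_of_lt_pi (by positivity) (by push_cast; linarith [Real.pi_pos])
    rw [← this] at h2
    simp at h2
  apply mul_left_cancel₀ h1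
  linear_combination zeta_five

theorem phi_conj : (starRingEnd ℂ) phi = phi := Complex.conj_ofReal _
theorem sqrtPhi_conj : (starRingEnd ℂ) sqrtPhi = sqrtPhi := Complex.conj_ofReal _
theorem sqrtPhi_sq : sqrtPhi ^ 2 = phi := by
  unfold sqrtPhi phi
  rw [← Complex.ofReal_pow, Real.sq_sqrt Real.goldenRatio_pos.le]

/-- The linear equations satisfied by the squares of the coordinates of a point of `X`. -/
def OnL (q : Fin 5 → ℂ) : Prop :=
  q 1 + q 2 + q 3 = 0 ∧ phi * q 1 + q 2 + q 4 = 0 ∧ (1 + phi) * q 1 + q 2 + q 5 = 0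

theorem OnL.comb {q q' : Fin 5 → ℂ} (h : OnL q) (h' : OnL q') (a b : ℂ) :
    OnL fun i => a * q i + b * q' i := by
  obtain ⟨h1, h2, h3⟩ := h
  obtain ⟨h1', h2', h3'⟩ := h'
  refine ⟨?_, ?_, ?_⟩
  · linear_combination a * h1 + b * h1'
  · linear_combination a * h2 + b * h2'
  · linear_combination a * h3 + b * h3'

theorem OnL.conj {q : Fin 5 → ℂ} (h : OnL q) : OnL fun i => (starRingEnd ℂ) (q i) := by
  obtain ⟨h1, h2, h3⟩ := h
  have h1 := congrArg (starRingEnd ℂ) h1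
  have h2 := congrArg (starRingEnd ℂ) h2
  have h3 := congrArg (starRingEnd ℂ) h3
  simp only [map_add, map_mul, map_zero, map_one, phi_conj] at h1 h2 h3
  exact ⟨h1, h2, h3⟩

theorem base_onL : OnL fun i => baseCoord i ^ 2 := by
  have h5 := zeta_five
  have hm := zeta_min
  have hp := phi_eq
  have hs := sqrtPhi_sq
  have hI := I_sq
  refine ⟨?_, ?_, ?_⟩ <;> simp only [baseCoord] <;> grind

theorem base_onL' : OnL fun i => baseCoord i ^ 2 * zeta ^ (2 * (i : ℕ)) := by
  have h5 := zeta_five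
  have hm := zeta_min
  have hp := phi_eq
  have hs := sqrtPhi_sq
  have hI := I_sq
  refine ⟨?_, ?_, ?_⟩ <;> simp [baseCoord, show (5 : Fin 5) = 0 from rfl] <;> grind

/-- Adjacency along colour `j` conjugates the `i`-th coordinate (normalised so that `x₁ = 1`) and
multiplies it by this sign. (The first row is the one of the coordinate `x 5`, the first column the
one of the colour `5`.) -/
def sgn (i j : Fin 5) : ℂ :=
  (![![-1, -1, -1, -1, 1], ![1, 1, 1, 1, 1], ![1, -1, -1, -1, -1], ![-1, -1, 1, 1, 1],
    ![-1, -1, -1, 1, 1]] : Fin 5 → Fin 5 → ℂ) i j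

theorem sgn_sq (i j : Fin 5) : sgn i j ^ 2 = 1 := by
  fin_cases i <;> fin_cases j <;> simp [sgn]

theorem sgn_conj (i j : Fin 5) : (starRingEnd ℂ) (sgn i j) = sgn i j := by
  fin_cases i <;> fin_cases j <;> simp [sgn]

/-- The product of the signs along a shortest path from `(1,1,1,1,1)` to `v`. -/
def eps (v : Vertex) (i : Fin 5) : ℂ := ∏ j, if v j = 0 then sgn i j else 1

theorem eps_sq (v : Vertex) (i : Fin 5) : eps v i ^ 2 = 1 := by
  unfold eps
  rw [← Finset.prod_pow]
  refine Finset.prod_eq_one fun j _ => ?_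
  split_ifs
  · exact sgn_sq i j
  · simp

theorem eps_nbr (v : Vertex) (i j : Fin 5) : eps (nbr v j) i = sgn i j * eps v i := by
  unfold eps
  rw [← Finset.mul_prod_erase _ _ (Finset.mem_univ j),
    ← Finset.mul_prod_erase (a := j) (s := Finset.univ)
      (f := fun j => if v j = 0 then sgn i j else 1) (Finset.mem_univ j), ← mul_assoc]
  congr 1
  · have h2 : ∀ a : ZMod 2, (a + 1 = 0 ∧ a ≠ 0) ∨ (a + 1 ≠ 0 ∧ a = 0) := by decide
    simp only [nbr, Pi.add_apply, Pi.single_eq_same]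
    rcases h2 (v j) with ⟨h, h'⟩ | ⟨h, h'⟩
    · simp [h, h']
    · simp [h', ← sq, sgn_sq]
  · refine Finset.prod_congr rfl fun l hl => ?_
    simp [nbr, Pi.single_eq_of_ne (Finset.ne_of_mem_erase hl)]

theorem sum_nbr (v : Vertex) (j : Fin 5) : ∑ i, nbr v j i = ∑ i, v i + 1 := by
  simp [nbr, Finset.sum_add_distrib]

theorem nbr_nbr (v : Vertex) (j : Fin 5) : nbr (nbr v j) j = v := by
  unfold nbr
  rw [add_assoc, ← Pi.single_add, show (1 + 1 : ZMod 2) = 0 from rfl]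
  simp

/-- The homogeneous coordinates of the vertex `v`. -/
def coord (v : Vertex) (i : Fin 5) : ℂ :=
  if ∑ l, v l = 1 then eps v i * baseCoord i else eps v i * (starRingEnd ℂ) (baseCoord i)

theorem coord_white {v : Vertex} (h : ∑ l, v l = 1) (i : Fin 5) :
    coord v i = eps v i * baseCoord i := if_pos h

theorem coord_black {v : Vertex} (h : ∑ l, v l ≠ 1) (i : Fin 5) :
    coord v i = eps v i * (starRingEnd ℂ) (baseCoord i) := if_neg h

theorem coord_sq_white {v : Vertex} (h : ∑ l, v l = 1) (i : Fin 5) :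
    coord v i ^ 2 = baseCoord i ^ 2 := by
  rw [coord_white h, mul_pow, eps_sq, one_mul]

theorem coord_sq_black {v : Vertex} (h : ∑ l, v l ≠ 1) (i : Fin 5) :
    coord v i ^ 2 = (starRingEnd ℂ) (baseCoord i ^ 2) := by
  rw [coord_black h, mul_pow, eps_sq, one_mul, map_pow]

theorem baseCoord_ne_zero (i : Fin 5) : baseCoord i ≠ 0 := by
  have h1 := zeta_ne_zero
  have h2 : sqrtPhi ≠ 0 := by
    intro h
    apply phi_ne_zero
    rw [← sqrtPhi_sq, h]
    norm_num
  fin_cases i <;> simp [baseCoord, h1, h2]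

theorem coord_ne_zero (v : Vertex) (i : Fin 5) : coord v i ≠ 0 := by
  have h : eps v i ≠ 0 := by
    intro h
    have := eps_sq v i
    rw [h] at this
    norm_num at this
  unfold coord
  split_ifs
  · exact mul_ne_zero h (baseCoord_ne_zero i)
  · exact mul_ne_zero h ((map_ne_zero _).mpr (baseCoord_ne_zero i))

theorem mem_X_of_onL {x : Fin 5 → ℂ} (h0 : x ≠ 0) (h : OnL fun i => x i ^ 2) : x ∈ X :=
  ⟨h0, h⟩

theorem coord_onL (v : Vertex) : OnL fun i => coord v i ^ 2 := by
  by_cases h : ∑ l, v l = 1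
  · simp only [coord_sq_white h]
    exact base_onL
  · simp only [coord_sq_black h]
    exact base_onL.conj

theorem coord_mem (v : Vertex) : coord v ∈ X :=
  mem_X_of_onL (fun h => coord_ne_zero v 0 (congrFun h 0)) (coord_onL v)

theorem base_white : baseCoord 1 ^ 2 * (zeta ^ 3 - zeta⁻¹) =
    baseCoord 2 ^ 2 * (zeta - zeta ^ 3) := by
  have h5 := zeta_five
  have hm := zeta_min
  have hp := phi_eq
  have hs := sqrtPhi_sq
  rw [zeta_inv]
  simp only [baseCoord]
  grind

theorem base_black : (starRingEnd ℂ) (baseCoord 1 ^ 2) * (zeta * (zeta ^ 3 - zeta⁻¹)) =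
    (starRingEnd ℂ) (baseCoord 2 ^ 2) * (zeta⁻¹ * (zeta - zeta ^ 3)) := by
  have h5 := zeta_five
  have hm := zeta_min
  have hp := phi_eq
  have hs := sqrtPhi_sq
  rw [zeta_inv]
  simp only [baseCoord, map_pow, map_mul, zeta_conj, sqrtPhi_conj, map_one]
  grind

/-- The principal square root. -/
def cs (z : ℂ) : ℂ := z ^ (2⁻¹ : ℂ)

theorem cs_sq (z : ℂ) : cs z ^ 2 = z := by
  have := Complex.cpow_nat_inv_pow z (n := 2) (by norm_num)
  exact_mod_cast this

theorem cs_ne_zero {z : ℂ} (h : z ≠ 0) : cs z ≠ 0 := by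
  intro h'
  apply h
  rw [← cs_sq z, h']
  norm_num

theorem cs_of_sq {y z : ℂ} (hy : 0 < y.re) (h : y ^ 2 = z) : cs z = y := by
  rw [← h]
  exact Complex.sq_cpow_two_inv hy

theorem cs_continuousAt {z : ℂ} (h : 0 ≤ z.re ∨ z.im ≠ 0) : ContinuousAt cs z :=
  Complex.continuousAt_cpow_const_of_re_pos h (by norm_num)

theorem pow_ne_one_of_odd (m : ℕ) (hm : Odd m) : zeta ^ m ≠ 1 := by
  intro h
  have h1 : (zeta ^ m) ^ 5 = -1 := by
    rw [← pow_mul, mul_comm, pow_mul, zeta_five, hm.neg_one_pow]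
  rw [h] at h1
  norm_num at h1

theorem norm_zeta_pow (m : ℕ) : ‖zeta ^ m‖ = 1 := by
  rw [zeta_pow_eq, Complex.norm_exp_ofReal_mul_I]

theorem zeta_two_ne_one : zeta ^ 2 ≠ 1 := by
  intro h
  have h5 := zeta_five
  have hm := zeta_min
  have : zeta = -1 := by linear_combination h5 - zeta * (zeta ^ 2 + 1) * h
  rw [this] at hm
  norm_num at hm

theorem zeta_pow_add_ten (m : ℕ) : zeta ^ (m + 10) = zeta ^ m := by
  rw [pow_add, show 10 = 5 * 2 from rfl, pow_mul zeta 5 2, zeta_five]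
  norm_num

/-- Odd powers of `ζ`. -/
theorem zeta_odd (m : ℕ) (hm : Odd m) :
    zeta ^ m = zeta ∨ zeta ^ m = zeta ^ 3 ∨ zeta ^ m = -1 ∨ zeta ^ m = -zeta ^ 2 ∨
      zeta ^ m = -zeta ^ 4 := by
  have h5 := zeta_five
  have h : zeta ^ m = zeta ^ (m % 10) := by
    conv_lhs => rw [← Nat.mod_add_div m 10, pow_add, pow_mul]
    rw [show zeta ^ 10 = 1 by rw [show 10 = 5 * 2 from rfl, pow_mul zeta 5 2, h5]; norm_num]
    simp
  have hm' : m % 10 = 1 ∨ m % 10 = 3 ∨ m % 10 = 5 ∨ m % 10 = 7 ∨ m % 10 = 9 := by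
    obtain ⟨l, rfl⟩ := hm
    omega
  rw [h]
  rcases hm' with h | h | h | h | h <;> rw [h]
  · left; ring
  · right; left; ring
  · right; right; left; exact h5
  · right; right; right; left; linear_combination zeta ^ 2 * h5
  · right; right; right; right; linear_combination zeta ^ 4 * h5

theorem zeta_pow_im_pos (n : ℕ) (h0 : 0 < n) (h5 : n < 5) : 0 < (zeta ^ n).im := by
  rw [zeta_pow_im]
  have h5' : (n : ℝ) < 5 := by exact_mod_cast h5
  have h0' : (0 : ℝ) < n := by exact_mod_cast h0
  apply Real.sin_pos_of_pos_of_lt_pi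
  · have := Real.pi_pos
    positivity
  · nlinarith [Real.pi_pos]

theorem zeta_odd_im (m : ℕ) (hm : Odd m) : zeta ^ m = -1 ∨ (zeta ^ m).im ≠ 0 := by
  have p1 := zeta_pow_im_pos 1 (by norm_num) (by norm_num)
  have p2 := zeta_pow_im_pos 2 (by norm_num) (by norm_num)
  have p3 := zeta_pow_im_pos 3 (by norm_num) (by norm_num)
  have p4 := zeta_pow_im_pos 4 (by norm_num) (by norm_num)
  rw [pow_one] at p1
  rcases zeta_odd m hm with h | h | h | h | h <;> rw [h]
  · right; exact p1.ne'
  · right; exact p3.ne'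
  · left; rfl
  · right; rw [Complex.neg_im]; linarith
  · right; rw [Complex.neg_im]; linarith

/-- Points of lifted paths: `[w_i √(t - s d_i)]`. -/
def liftPoint (w d : Fin 5 → ℂ) (t s : ℝ) (i : Fin 5) : ℂ := w i * cs (t - s * d i)

theorem liftPoint_mem {w d : Fin 5 → ℂ} (hw : OnL fun i => w i ^ 2)
    (hd : OnL fun i => w i ^ 2 * d i) (t s : ℝ) (h0 : ∃ i, w i ≠ 0 ∧ (t : ℂ) - s * d i ≠ 0) :
    liftPoint w d t s ∈ X := by
  refine mem_X_of_onL ?_ ?_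
  · intro h
    obtain ⟨i, h1, h2⟩ := h0
    exact mul_ne_zero h1 (cs_ne_zero h2) (congrFun h i)
  · have := hw.comb hd t (-s)
    convert this using 2 with i
    rw [liftPoint, mul_pow, cs_sq]
    ring

theorem liftPoint_zero (w d : Fin 5 → ℂ) : liftPoint w d 1 0 = w := by
  funext i
  simp [liftPoint, cs]

/-- The constants `d_i` for lifts to edges of colour `j` from their white ends. -/
def dEdge (j i : Fin 5) : ℂ := zeta ^ (2 * (i : ℕ) + (17 - 2 * (j : ℕ)))

theorem edge_odd (i j : Fin 5) : Odd (2 * (i : ℕ) + (17 - 2 * (j : ℕ))) := by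
  revert i j
  decide

theorem dEdge_onL (j : Fin 5) : OnL fun i => baseCoord i ^ 2 * dEdge j i := by
  have := base_onL'.comb base_onL' (zeta ^ (17 - 2 * (j : ℕ))) 0
  convert this using 2 with i
  rw [dEdge, pow_add]
  ring

theorem dEdge_ne (j i : Fin 5) {t s : ℝ} (ht : 0 ≤ t) (hs : 0 ≤ s) (h : t + s = 1) :
    (t : ℂ) - s * dEdge j i ≠ 0 := by
  intro h0
  have h1 : (t : ℂ) = s * dEdge j i := sub_eq_zero.mp h0
  have h2 := congrArg norm h1
  rw [norm_mul, dEdge, norm_zeta_pow, Complex.norm_real, Complex.norm_real, mul_one,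
    Real.norm_of_nonneg ht, Real.norm_of_nonneg hs] at h2
  have h3 : t ≠ 0 := by
    intro h3
    linarith
  rw [← h2] at h1
  have h4 : (t : ℂ) ≠ 0 := by exact_mod_cast h3
  refine pow_ne_one_of_odd _ (edge_odd i j) (mul_left_cancel₀ h4 ?_)
  rw [mul_one]
  exact h1.symm

theorem dEdge_slit (j i : Fin 5) {t s : ℝ} (ht : 0 ≤ t) (hs : 0 ≤ s) :
    0 ≤ ((t : ℂ) - s * dEdge j i).re ∨ ((t : ℂ) - s * dEdge j i).im ≠ 0 := by
  rcases hs.eq_or_lt with rfl | hs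
  · left
    simpa using ht
  · rcases zeta_odd_im _ (edge_odd i j) with h | h
    · left
      rw [dEdge, h]
      simp
      linarith
    · right
      rw [dEdge]
      simp only [Complex.sub_im, Complex.ofReal_im, Complex.im_ofReal_mul]
      intro h'
      apply h
      have : s * (zeta ^ (2 * (i : ℕ) + (17 - 2 * (j : ℕ)))).im = 0 := by linarith
      exact (mul_eq_zero.mp this).resolve_left hs.ne'

/-- The value of the root at the black end. -/
theorem cs_edge (i j : Fin 5) :
    cs (-dEdge j i) = zeta ^ (8 + (2 * (i : ℕ) + (17 - 2 * (j : ℕ))) % 10 / 2) := by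
  have h5 := zeta_five
  apply cs_of_sq
  · rw [zeta_pow_re]
    have h : (2 * (i : ℕ) + (17 - 2 * (j : ℕ))) % 10 / 2 < 5 := by omega
    generalize (2 * (i : ℕ) + (17 - 2 * (j : ℕ))) % 10 / 2 = n at h
    have h' : (n : ℝ) ≤ 4 := by exact_mod_cast Nat.le_of_lt_succ h
    have h0 : (0 : ℝ) ≤ n := by positivity
    rw [← Real.cos_sub_two_pi]
    apply Real.cos_pos_of_mem_Ioo
    push_cast
    constructor <;> nlinarith [Real.pi_pos]
  · unfold dEdge
    obtain ⟨l, hl⟩ := edge_odd i j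
    generalize 2 * (i : ℕ) + (17 - 2 * (j : ℕ)) = m at hl
    have h1 : 2 * (8 + m % 10 / 2) + 10 * (m / 10) = 15 + m := by omega
    have h2 : zeta ^ (2 * (8 + m % 10 / 2) + 10 * (m / 10)) =
        (zeta ^ (8 + m % 10 / 2)) ^ 2 := by
      rw [pow_add, pow_mul zeta 10, show zeta ^ 10 = 1 by
        rw [show 10 = 5 * 2 from rfl, pow_mul zeta 5 2, h5]; norm_num, one_pow, mul_one, mul_comm,
        pow_mul]
    rw [← h2, h1, pow_add, show 15 = 5 * 3 from rfl, pow_mul, h5]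
    ring

theorem edge_end (i j : Fin 5) : baseCoord i * cs (-dEdge j i) =
    cs (-dEdge j 1) * (sgn i j * (starRingEnd ℂ) (baseCoord i)) := by
  have h5 := zeta_five
  rw [cs_edge, cs_edge]
  fin_cases i <;> fin_cases j <;>
    simp [sgn, baseCoord, zeta_conj, sqrtPhi_conj] <;> grind

theorem X_smul {x : Fin 5 → ℂ} (hx : x ∈ X) {c : ℂ} (hc : c ≠ 0) : c • x ∈ X := by
  obtain ⟨h0, h1, h2, h3⟩ := hx
  refine ⟨smul_ne_zero hc h0, ?_, ?_, ?_⟩ <;> simp only [Pi.smul_apply, smul_eq_mul]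
  · linear_combination c ^ 2 * h1
  · linear_combination c ^ 2 * h2
  · linear_combination c ^ 2 * h3

theorem liesOver_smul {x : Fin 5 → ℂ} {u v : ℂ} (h : LiesOver x u v) (c : ℂ) :
    LiesOver (c • x) u v := by
  unfold LiesOver at *
  simp only [Pi.smul_apply, smul_eq_mul]
  linear_combination c ^ 2 * h

theorem edge_smul (j : Fin 5) {x : Fin 5 → ℂ} (hx : x ∈ edgePreimage j) {c : ℂ} (hc : c ≠ 0) :
    c • x ∈ edgePreimage j := by
  obtain ⟨h, r, s, hr, hs, h0, hl⟩ := hx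
  exact ⟨X_smul h hc, r, s, hr, hs, h0, liesOver_smul hl c⟩

theorem joinedIn_smul {F : Set (Fin 5 → ℂ)} (hF : ∀ x ∈ F, ∀ c : ℂ, c ≠ 0 → c • x ∈ F)
    {x : Fin 5 → ℂ} (hx : x ∈ F) {c : ℂ} (hc : c ≠ 0) : JoinedIn F x (c • x) := by
  have h1 : IsPathConnected ({0}ᶜ : Set ℂ) :=
    isPathConnected_compl_singleton_of_one_lt_rank (by simp) 0
  have h2 := h1.joinedIn 1 (by simp) c hc
  have h3 := h2.map (f := fun a : ℂ => a • x) (by fun_prop)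
  rw [one_smul] at h3
  refine h3.mono ?_
  rintro _ ⟨a, ha, rfl⟩
  exact hF x hx a ha

theorem liftPoint_continuousOn {w d : Fin 5 → ℂ} {f g : ℝ → ℝ} (hf : Continuous f)
    (hg : Continuous g) {S : Set ℝ}
    (h : ∀ τ ∈ S, ∀ i, 0 ≤ ((f τ : ℂ) - g τ * d i).re ∨ ((f τ : ℂ) - g τ * d i).im ≠ 0) :
    ContinuousOn (fun τ => liftPoint w d (f τ) (g τ)) S := by
  rw [continuousOn_pi]
  intro i τ hτ
  refine ContinuousAt.continuousWithinAt ?_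
  refine continuousAt_const.mul ?_
  exact ContinuousAt.comp (f := fun τ : ℝ => (f τ : ℂ) - g τ * d i)
    (cs_continuousAt (h τ hτ i)) (by fun_prop)

theorem liesOver_white {v : Vertex} (h : ∑ l, v l = 1) : LiesOver (coord v) 1 0 := by
  unfold LiesOver
  rw [coord_sq_white h, coord_sq_white h]
  linear_combination base_white

theorem liesOver_black {v : Vertex} (h : ∑ l, v l ≠ 1) : LiesOver (coord v) 0 1 := by
  unfold LiesOver
  rw [coord_sq_black h, coord_sq_black h]
  linear_combination -base_black

theorem liesOver_liftPoint_white {w d : Fin 5 → ℂ} (hw : LiesOver w 1 0) {a : ℂ}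
    (h1 : a * d 1 = zeta⁻¹) (h2 : a * d 2 = zeta) (t s : ℝ) :
    LiesOver (liftPoint w d t s) (t * a) s := by
  unfold LiesOver at *
  simp only [liftPoint, mul_pow, cs_sq]
  have e1 : (t : ℂ) * a - zeta⁻¹ * s = a * (t - s * d 1) := by rw [← h1]; ring
  have e2 : (t : ℂ) * a - zeta * s = a * (t - s * d 2) := by rw [← h2]; ring
  rw [e1, e2]
  linear_combination ((t : ℂ) - s * d 1) * (t - s * d 2) * a * hw

theorem liesOver_liftPoint_black {w d : Fin 5 → ℂ} (hw : LiesOver w 0 1) {a : ℂ}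
    (h1 : a = zeta⁻¹ * d 1) (h2 : a = zeta * d 2) (t s : ℝ) :
    LiesOver (liftPoint w d t s) (s * a) t := by
  unfold LiesOver at *
  simp only [liftPoint, mul_pow, cs_sq]
  have e1 : (s : ℂ) * a - zeta⁻¹ * t = -zeta⁻¹ * (t - s * d 1) := by rw [h1]; ring
  have e2 : (s : ℂ) * a - zeta * t = -zeta * (t - s * d 2) := by rw [h2]; ring
  rw [e1, e2]
  linear_combination ((t : ℂ) - s * d 1) * (t - s * d 2) * hw

theorem white_nbr {v : Vertex} (h : ∑ l, v l = 1) (j : Fin 5) : ∑ l, nbr v j l ≠ 1 := by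
  rw [sum_nbr, h]
  decide

theorem edge_joined_white {v : Vertex} (h : ∑ l, v l = 1) (j : Fin 5) :
    JoinedIn (edgePreimage j) (coord v) (coord (nbr v j)) := by
  set c := cs (-dEdge j 1) with hc
  have hc0 : c ≠ 0 := cs_ne_zero (neg_ne_zero.mpr (pow_ne_zero _ zeta_ne_zero))
  have hend : liftPoint (coord v) (dEdge j) 0 1 = c • coord (nbr v j) := by
    funext i
    have := edge_end i j
    simp only [liftPoint, Pi.smul_apply, smul_eq_mul, coord_white h, coord_black (white_nbr h j),
      eps_nbr]
    push_cast
    rw [zero_sub, one_mul]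
    linear_combination eps v i * this
  have hd : OnL fun i => coord v i ^ 2 * dEdge j i := by
    simp only [coord_sq_white h]
    exact dEdge_onL j
  have hj : JoinedIn (edgePreimage j) (coord v) (c • coord (nbr v j)) := by
    refine JoinedIn.ofLine (f := fun τ : ℝ => liftPoint (coord v) (dEdge j) (1 - τ) τ)
      (liftPoint_continuousOn (by fun_prop) (by fun_prop) ?_) ?_ ?_ ?_
    · rintro τ ⟨h0, h1⟩ i
      exact dEdge_slit j i (sub_nonneg.mpr h1) h0
    · simp only [sub_zero]
      exact liftPoint_zero _ _
    · simp only [sub_self]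
      exact hend
    · rintro _ ⟨τ, ⟨h0, h1⟩, rfl⟩
      refine ⟨liftPoint_mem (coord_onL v) hd _ _ ⟨0, coord_ne_zero v 0,
        dEdge_ne j 0 (sub_nonneg.mpr h1) h0 (by ring)⟩, 1 - τ, τ, sub_nonneg.mpr h1, h0, ?_,
        liesOver_liftPoint_white (liesOver_white h) ?_ ?_ _ _⟩
      · by_contra! hcon
        linarith [hcon.1, hcon.2]
      · rw [dEdge, ← pow_add, zeta_inv]
        fin_cases j <;> simp <;> grind [zeta_five]
      · rw [dEdge, ← pow_add]
        fin_cases j <;> simp <;> grind [zeta_five]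
  refine hj.trans ?_
  have := joinedIn_smul (fun x hx c hc => edge_smul j hx hc) hj.target_mem (inv_ne_zero hc0)
  rwa [inv_smul_smul₀ hc0] at this

theorem zmod_two_eq (a : ZMod 2) (h : a ≠ 1) : a = 0 := by
  revert a
  decide

theorem edge_joined (v : Vertex) (j : Fin 5) :
    JoinedIn (edgePreimage j) (coord v) (coord (nbr v j)) := by
  by_cases h : ∑ l, v l = 1
  · exact edge_joined_white h j
  · have h' : ∑ l, nbr v j l = 1 := by
      rw [sum_nbr, zmod_two_eq _ h, zero_add]
    have := edge_joined_white h' j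
    rw [nbr_nbr] at this
    exact this.symm

/-- The constants `d_i` for lifts to `(j, j+1)`-coloured faces from their white corners. -/
def dWhite (j i : Fin 5) : ℂ := zeta ^ (2 * (i : ℕ) + (16 - 2 * (j : ℕ)))

/-- The constants `d_i` for lifts to `(j, j+1)`-coloured faces from their black corners. -/
def dBlack (j i : Fin 5) : ℂ := (starRingEnd ℂ) (zeta ^ (2 * (i : ℕ))) * zeta ^ (2 * (j : ℕ) + 4)

theorem dWhite_onL (j : Fin 5) : OnL fun i => baseCoord i ^ 2 * dWhite j i := by
  have := base_onL'.comb base_onL' (zeta ^ (16 - 2 * (j : ℕ))) 0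
  convert this using 2 with i
  rw [dWhite, pow_add]
  ring

theorem dBlack_onL (j : Fin 5) :
    OnL fun i => (starRingEnd ℂ) (baseCoord i ^ 2) * dBlack j i := by
  have := base_onL'.conj.comb base_onL'.conj (zeta ^ (2 * (j : ℕ) + 4)) 0
  convert this using 2 with i
  rw [dBlack, map_mul]
  ring

theorem norm_dWhite (j i : Fin 5) : ‖dWhite j i‖ = 1 := norm_zeta_pow _

theorem norm_dBlack (j i : Fin 5) : ‖dBlack j i‖ = 1 := by
  rw [dBlack, norm_mul, RCLike.norm_conj, norm_zeta_pow, norm_zeta_pow, one_mul]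

theorem face_slit {d : ℂ} (hd : ‖d‖ = 1) {s : ℝ} (h0 : 0 ≤ s) (h1 : s ≤ 1) :
    0 ≤ (((1 : ℝ) : ℂ) - s * d).re := by
  have := Complex.re_le_norm d
  rw [hd] at this
  simp only [Complex.sub_re, Complex.ofReal_re, Complex.re_ofReal_mul]
  nlinarith

theorem face_ne {d : ℂ} (hd : ‖d‖ = 1) (hd1 : d ≠ 1) {s : ℝ} (h0 : 0 ≤ s) :
    ((1 : ℝ) : ℂ) - s * d ≠ 0 := by
  intro h
  have h1 : ((1 : ℝ) : ℂ) = s * d := sub_eq_zero.mp h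
  have h2 := congrArg norm h1
  rw [norm_mul, hd, Complex.norm_real, Complex.norm_real, mul_one,
    Real.norm_of_nonneg h0, norm_one] at h2
  rw [← h2] at h1
  apply hd1
  simpa using h1.symm

theorem face_sector (j : Fin 5) : (((phi⁻¹).re : ℝ) : ℂ) * zeta ^ (2 * (j : ℕ)) +
    (((phi⁻¹).re : ℝ) : ℂ) * zeta ^ (2 * (j : ℕ) + 2) = zeta ^ (2 * (j : ℕ) + 1) := by
  have h : (((phi⁻¹).re : ℝ) : ℂ) = phi⁻¹ := by
    unfold phi
    rw [← Complex.ofReal_inv, Complex.ofReal_re]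
  rw [h, ← mul_add, inv_mul_eq_iff_eq_mul₀ phi_ne_zero, phi_eq]
  have h5 := zeta_five
  rw [pow_add, pow_add]
  linear_combination zeta ^ (2 * (j : ℕ)) * h5

theorem phi_inv_re_pos : 0 < (phi⁻¹).re := by
  unfold phi
  rw [← Complex.ofReal_inv, Complex.ofReal_re]
  exact inv_pos.mpr Real.goldenRatio_pos

/-- The homogeneous coordinates of the center of the `(j, j+1)`-coloured face at `v`: the end of
the lift, starting at `v`, of the path from `η(∞)` (or `η(0)`) to `η(ζ^(2j+1))`. -/
def faceCoord (j : Fin 5) (v : Vertex) : Fin 5 → ℂ :=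
  if ∑ l, v l = 1 then liftPoint (coord v) (dWhite j) 1 1 else liftPoint (coord v) (dBlack j) 1 1

theorem dWhite_ne (j : Fin 5) : dWhite j (j + 3) ≠ 1 := by
  have : dWhite j (j + 3) = zeta ^ 2 := by
    rw [dWhite]
    fin_cases j <;> simp <;> grind [zeta_five]
  rw [this]
  exact zeta_two_ne_one

theorem dBlack_ne (j : Fin 5) : dBlack j (j + 1) ≠ 1 := by
  have : dBlack j (j + 1) = zeta ^ 2 := by
    rw [dBlack, map_pow, zeta_conj]
    fin_cases j <;> simp <;> grind [zeta_five]
  rw [this]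
  exact zeta_two_ne_one

theorem face_spec (j : Fin 5) (v : Vertex) : faceCoord j v ∈ X ∧
    LiesOver (faceCoord j v) (zeta ^ (2 * (j : ℕ) + 1)) 1 ∧
    JoinedIn (facePreimage j) (coord v) (faceCoord j v) := by
  have hpos := phi_inv_re_pos
  by_cases h : ∑ l, v l = 1
  · have e : faceCoord j v = liftPoint (coord v) (dWhite j) 1 1 := if_pos h
    have hd : OnL fun i => coord v i ^ 2 * dWhite j i := by
      simp only [coord_sq_white h]
      exact dWhite_onL j
    have hX : ∀ s : ℝ, 0 ≤ s → liftPoint (coord v) (dWhite j) 1 s ∈ X := fun s hs =>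
      liftPoint_mem (coord_onL v) hd _ _ ⟨j + 3, coord_ne_zero v _,
        face_ne (norm_dWhite _ _) (dWhite_ne j) hs⟩
    have hL : ∀ s : ℝ, LiesOver (liftPoint (coord v) (dWhite j) 1 s)
        (((1 : ℝ) : ℂ) * zeta ^ (2 * (j : ℕ) + 1)) s := fun s => by
      refine liesOver_liftPoint_white (liesOver_white h) ?_ ?_ _ _
      · rw [dWhite, ← pow_add, zeta_inv]
        fin_cases j <;> simp <;> grind [zeta_five]
      · rw [dWhite, ← pow_add]
        fin_cases j <;> simp <;> grind [zeta_five]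
    rw [e]
    refine ⟨hX 1 zero_le_one, by simpa using hL 1, ?_⟩
    refine JoinedIn.ofLine (f := fun τ : ℝ => liftPoint (coord v) (dWhite j) 1 τ)
      (liftPoint_continuousOn (by fun_prop) (by fun_prop) ?_) (liftPoint_zero _ _) rfl ?_
    · rintro τ ⟨h0, h1⟩ i
      exact Or.inl (face_slit (norm_dWhite j i) h0 h1)
    · rintro _ ⟨τ, ⟨h0, h1⟩, rfl⟩
      refine ⟨hX τ h0, (phi⁻¹).re, (phi⁻¹).re, τ, hpos.le, hpos.le, h0, Or.inl hpos.ne', ?_⟩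
      rw [face_sector]
      simpa using hL τ
  · have e : faceCoord j v = liftPoint (coord v) (dBlack j) 1 1 := if_neg h
    have hd : OnL fun i => coord v i ^ 2 * dBlack j i := by
      simp only [coord_sq_black h]
      exact dBlack_onL j
    have hX : ∀ s : ℝ, 0 ≤ s → liftPoint (coord v) (dBlack j) 1 s ∈ X := fun s hs =>
      liftPoint_mem (coord_onL v) hd _ _ ⟨j + 1, coord_ne_zero v _,
        face_ne (norm_dBlack _ _) (dBlack_ne j) hs⟩
    have hL : ∀ s : ℝ, LiesOver (liftPoint (coord v) (dBlack j) 1 s)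
        (s * zeta ^ (2 * (j : ℕ) + 1)) ((1 : ℝ) : ℂ) := fun s => by
      refine liesOver_liftPoint_black (liesOver_black h) ?_ ?_ _ _
      · rw [dBlack, map_pow, zeta_conj, zeta_inv]
        fin_cases j <;> simp <;> grind [zeta_five]
      · rw [dBlack, map_pow, zeta_conj]
        fin_cases j <;> simp <;> grind [zeta_five]
    rw [e]
    refine ⟨hX 1 zero_le_one, by simpa using hL 1, ?_⟩
    refine JoinedIn.ofLine (f := fun τ : ℝ => liftPoint (coord v) (dBlack j) 1 τ)
      (liftPoint_continuousOn (by fun_prop) (by fun_prop) ?_) (liftPoint_zero _ _) rfl ?_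
    · rintro τ ⟨h0, h1⟩ i
      exact Or.inl (face_slit (norm_dBlack j i) h0 h1)
    · rintro _ ⟨τ, ⟨h0, h1⟩, rfl⟩
      refine ⟨hX τ h0, τ * (phi⁻¹).re, τ * (phi⁻¹).re, 1, mul_nonneg h0 hpos.le,
        mul_nonneg h0 hpos.le, zero_le_one, Or.inr (Or.inr one_ne_zero), ?_⟩
      have := face_sector j
      push_cast
      rw [mul_assoc, mul_assoc, ← mul_add, this]
      simpa using hL τ

/-- The embedding of `H⁵` in `X`, in explicit homogeneous coordinates. -/
def hypercubeEmbedding : Embedding where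
  vertex v := ⟨coord v, coord_mem v⟩
  faceCenter j v := ⟨faceCoord j v, (face_spec j v).1⟩
  vertex_base := by
    funext i
    have h : ∑ l, (1 : Vertex) l = 1 := by decide
    simp [coord_white h, eps]
  vertex_white _ h := liesOver_white h
  vertex_black _ h := liesOver_black (by rw [h]; decide)
  vertex_edge := edge_joined
  faceCenter_over j v := (face_spec j v).2.1
  faceCenter_face j v := (face_spec j v).2.2

/-! ### The elliptic curves `E_k` and the maps `ν_k : X → E_k` -/

/-- `E_k : y² = x (x - 1) (x - root k)`. -/
def root : Fin 5 → ℂ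
  | 0 => phi -- `k = 5`
  | 1 => phi + 1
  | 2 => phi
  | 3 => -phi
  | 4 => phi + 1

/-- The elliptic curve `y² = x (x - 1) (x - root k)`. -/
def E (k : Fin 5) : WeierstrassCurve.Affine ℂ where
  a₁ := 0
  a₂ := -(1 + root k)
  a₃ := 0
  a₄ := root k
  a₆ := 0

/-- The first affine coordinate of `ν_k`. -/
def nuX : Fin 5 → (Fin 5 → ℂ) → ℂ
  | 0, x => -(x 5 ^ 2 / x 4 ^ 2) + phi + 1 -- `k = 5`
  | 1, x => -(2 * phi + 1) * (x 1 ^ 2 / x 5 ^ 2) - phi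
  | 2, x => x 2 ^ 2 / x 1 ^ 2 + phi + 1
  | 3, x => (2 * phi + 1) * (x 3 ^ 2 / x 2 ^ 2) + phi + 1
  | 4, x => (phi + 1) * (x 4 ^ 2 / x 3 ^ 2) - phi

/-- The second affine coordinate of `ν_k`. -/
def nuY : Fin 5 → (Fin 5 → ℂ) → ℂ
  | 0, x => I * (x 1 * x 2 * x 3 / x 4 ^ 3) -- `k = 5`
  | 1, x => (2 * phi + 1) * (x 2 * x 3 * x 4 / x 5 ^ 3)
  | 2, x => I * (x 3 * x 4 * x 5 / x 1 ^ 3)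
  | 3, x => I * (2 * phi + 1) * (x 1 * x 4 * x 5 / x 2 ^ 3)
  | 4, x => I * phi * (x 1 * x 2 * x 5 / x 3 ^ 3)

theorem E_disc_ne_zero (k : Fin 5) : (E k).Δ ≠ 0 := by
  have h0 : root k ≠ 0 := by
    fin_cases k <;> simp [root, phi_ne_zero, phi_add_one_ne_zero]
  have h1 : root k - 1 ≠ 0 := by
    fin_cases k <;>
      simp [root, phi_ne_zero, phi_sub_one_ne_zero]
    intro h
    apply phi_add_one_ne_zero
    linear_combination -h
  have : (E k).Δ = 16 * (root k) ^ 2 * (root k - 1) ^ 2 := by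
    simp only [E, WeierstrassCurve.Δ, WeierstrassCurve.b₂, WeierstrassCurve.b₄,
      WeierstrassCurve.b₆, WeierstrassCurve.b₈]
    ring
  rw [this]
  exact mul_ne_zero (mul_ne_zero (by norm_num) (pow_ne_zero _ h0)) (pow_ne_zero _ h1)

theorem nu_nonsingular (k : Fin 5) (x : X) (hx : (x : Fin 5 → ℂ) (k - 1) ≠ 0) :
    (E k).Nonsingular (nuX k x) (nuY k x) := by
  rw [← WeierstrassCurve.Affine.equation_iff_nonsingular_of_Δ_ne_zero (E_disc_ne_zero k),
    WeierstrassCurve.Affine.equation_iff]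
  obtain ⟨x, hX, h1, h2, h3⟩ := x
  change x (k - 1) ≠ 0 at hx
  have hp := phi_sq
  have hI := I_sq
  change nuY k x ^ 2 + (E k).a₁ * nuX k x * nuY k x + (E k).a₃ * nuY k x =
    nuX k x ^ 3 + (E k).a₂ * nuX k x ^ 2 + (E k).a₄ * nuX k x + (E k).a₆
  clear hX
  fin_cases k
  · change x 4 ≠ 0 at hx
    simp only [nuX, nuY, E, root]
    field_simp
    grind
  · change x 5 ≠ 0 at hx
    simp only [nuX, nuY, E, root]
    field_simp
    grind
  · change x 1 ≠ 0 at hx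
    simp only [nuX, nuY, E, root]
    field_simp
    grind
  · change x 2 ≠ 0 at hx
    simp only [nuX, nuY, E, root]
    field_simp
    grind
  · change x 3 ≠ 0 at hx
    simp only [nuX, nuY, E, root]
    field_simp
    grind

/-- `ν_k : X → E_k`; it has a pole, and takes the value `O_k`, where `x_{k-1} = 0`. -/
def nu (k : Fin 5) (x : X) : (E k).Point :=
  open Classical in
  if hx : (x : Fin 5 → ℂ) (k - 1) = 0 then 0
  else .some (nuX k x) (nuY k x) (nu_nonsingular k x hx)

namespace Embedding

/-- The point of `X` given by a vertex or a face center. -/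
def point (A : Embedding) : Vertex ⊕ Face → X :=
  Sum.elim A.vertex fun f => A.faceCenter f.1.1 f.1.2

/-- `ν_k(D) = ∑ κ_P ν_k(P)` for a divisor `D = ∑ κ_P P` on the vertices and face centers. -/
def nuDivisor (A : Embedding) (k : Fin 5) (D : (Vertex ⊕ Face) →₀ ℤ) : (E k).Point :=
  D.sum fun P n => n • nu k (A.point P)

/-- `e^k_∞ = ν_k(w₀)`. -/
def eInf (A : Embedding) (k : Fin 5) : (E k).Point := nu k (A.vertex 1)

/-- `e^k_4 = ν_k(f_{k-2,k-1}(1,1,1,1,1))`. -/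
def eFour (A : Embedding) (k : Fin 5) : (E k).Point := nu k (A.faceCenter (k - 2) 1)

/-- `e^k_2 = ν_k(f_{k,k+1}(1,1,1,1,1))`. -/
def eTwo (A : Embedding) (k : Fin 5) : (E k).Point := nu k (A.faceCenter k 1)

end Embedding

end Adinkra

end

noncomputable section

namespace Adinkra

open Complex WeierstrassCurve.Affine ComplexConjugate

/-! ### The group law of `y² = x (x - 1) (x - root k)` -/

/-! The divisor image is computed exactly: `ν_k(D_h) = n (e^k_∞ - e^k_4)` for an integer `n` with
`|n| ≤ 8`. The relations among the three points then determine what any other representation can be.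

Values of `ν_k`. Write `ε(v) = ±1` according to whether `v_k` and `v_{k+2}` agree, and `p(v) = ±1`
for the parity of `v`. In explicit coordinates, crossing an edge is complex conjugation up to signs.
The second coordinate of `ν_k` is odd in every `x_i` with `i ≠ k`, so only `ε` and the conjugation
survive. A chord computation relates `e^k_∞` to its conjugate and gives `ν_k(v) = ε e_4 + ε p (e_∞ -
e_4)` (`nu_vertex`). The centers of the faces `(j, j+1)` map to `ε e_4`, `2 e_4`, `e_2`, `2 e_4 +
e_2`, `O` for `j = k-2, …, k+2`.

Combinatorics. Twice the coefficient of a vertex is a sum over the five faces at it, minus 2. Both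
weights `ε` and `ε p` change sign between opposite corners of every face with `j ≠ k-2`, so only the
faces `(k-2, k-1)` contribute (`sum_vertexCoeff_mul_eq`). For `ε` the result cancels against the
centers of these faces. For `ε p` each of the eight faces contributes at most 1 in absolute value.
The number of bow ties with colours `j, j+1` has a parity independent of `j`, so the 2-torsion terms
cancel (`divisor_relation`).

Independence. `e_4` has order 4, and `e_2` is a point of order 2 other than `2 e_4`. `e_∞` has
infinite order: at a place above 2, its double has a non-integral first coordinate, and further
doubling only increases the denominator (`eInf_not_isOfFinAddOrder`). -/

theorem E_nonsingular_iff {k : Fin 5} {x y : ℂ} :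
    (E k).Nonsingular x y ↔ y ^ 2 = x * (x - 1) * (x - root k) := by
  rw [← equation_iff_nonsingular_of_Δ_ne_zero (E_disc_ne_zero k), equation_iff]
  change y ^ 2 + 0 * x * y + 0 * y = x ^ 3 + -(1 + root k) * x ^ 2 + root k * x + 0 ↔ _
  constructor <;> intro h <;> linear_combination h

theorem E_neg_some {k : Fin 5} {x y : ℂ} (h : (E k).Nonsingular x y)
    (h' : (E k).Nonsingular x (-y)) : -Point.some x y h = Point.some x (-y) h' := by
  rw [Point.neg_some]
  simp [negY, E]

/-- The hypothesis `hy` puts the three points on one line, of slope `y / (x - t)`. The hypothesis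
`hs` is Vieta's formula for its three intersections with the cubic, with `y²` eliminated. The third
intersection `(t, 0)` is its own negative. -/
theorem E_add_collinear {k : Fin 5} {x y x' y' t : ℂ} (h : (E k).Nonsingular x y)
    (h' : (E k).Nonsingular x' y') (ht : (E k).Nonsingular t 0) (hx : x ≠ x') (hxt : x ≠ t)
    (hy : y' * (x - t) = y * (x' - t))
    (hs : (x - t) ^ 2 * (t + x + x' - 1 - root k) = x * (x - 1) * (x - root k)) :
    Point.some x y h + Point.some x' y' h' = Point.some t 0 ht := by
  have e := E_nonsingular_iff.mp h
  have hxt' := sub_ne_zero.mpr hxt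
  have hx' := sub_ne_zero.mpr hx
  have hl : (E k).slope x x' y y' = y / (x - t) := by
    rw [slope_of_X_ne hx, div_eq_div_iff hx' hxt']
    linear_combination -hy
  have hX : (E k).addX x x' (y / (x - t)) = t := by
    simp only [addX, E]
    field_simp
    linear_combination e - hs
  rw [Point.add_of_X_ne hx]
  simp only [hl, Point.some.injEq]
  refine ⟨hX, ?_⟩
  simp only [addY, negAddY, negY, hX]
  simp only [E]
  field_simp
  ring

/-- The chord is the line `y = 0`, and `h` is Vieta's formula for the roots of the cubic. -/
theorem E_add_two_torsion {k : Fin 5} {a b c : ℂ} (ha : (E k).Nonsingular a 0)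
    (hb : (E k).Nonsingular b 0) (hc : (E k).Nonsingular c 0) (hab : a ≠ b)
    (h : a + b + c = 1 + root k) :
    Point.some a 0 ha + Point.some b 0 hb = Point.some c 0 hc := by
  have hl : (E k).slope a b 0 0 = 0 := by simp [slope_of_X_ne hab]
  have hX : (E k).addX a b 0 = c := by
    simp only [addX, E]
    linear_combination -h
  rw [Point.add_of_X_ne hab]
  simp only [hl, Point.some.injEq]
  refine ⟨hX, ?_⟩
  simp [addY, negAddY, negY, E]

theorem E_two_torsion {k : Fin 5} {a : ℂ} (ha : (E k).Nonsingular a 0) :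
    (2 : ℤ) • Point.some a 0 ha = 0 := by
  rw [two_zsmul, Point.add_self_of_Y_eq]
  simp [negY, E]

/-- The duplication formula `x(2P) = (x² - r)² / (4 y²)`, with `r = root k`. The factor 4 in the
denominator drives the 2-adic argument. -/
theorem E_double {k : Fin 5} {x y : ℂ} (h : (E k).Nonsingular x y) (hy : y ≠ 0) :
    ∃ X Y, ∃ h' : (E k).Nonsingular X Y, (2 : ℤ) • Point.some x y h = Point.some X Y h' ∧
      X * (4 * y ^ 2) = (x ^ 2 - root k) ^ 2 := by
  have e := E_nonsingular_iff.mp h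
  have hy' : y ≠ (E k).negY x y := by
    simp only [negY, E]
    intro h
    apply hy
    linear_combination h / 2
  rw [two_zsmul, Point.add_self_of_Y_ne hy']
  refine ⟨_, _, _, rfl, ?_⟩
  have hl : (E k).slope x x y y = (3 * x ^ 2 - 2 * (1 + root k) * x + root k) / (2 * y) := by
    rw [slope_of_Y_ne rfl hy']
    simp only [negY, E]
    congr 1 <;> ring
  rw [hl]
  simp only [addX, E]
  field_simp
  linear_combination (16 * (1 + root k) - 32 * x) * e

/-! ### A 2-adic criterion for points of infinite order -/

/-- The local ring `ℤ_(2)` maps to `K` and is dominated by a valuation ring of `K`. Taking `K = ℂ`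
avoids any descent of the curves to a number field. -/
theorem exists_valuationSubring_two (K : Type*) [Field K] [CharZero K] :
    ∃ A : ValuationSubring K, A.valuation 2 < 1 := by
  let p : Ideal ℤ := Ideal.span {2}
  have : p.IsPrime :=
    (Ideal.span_singleton_prime two_ne_zero).mpr Int.prime_two
  have hu : ∀ y : p.primeCompl, IsUnit (Int.castRingHom K y) := by
    rintro ⟨y, hy⟩
    rw [isUnit_iff_ne_zero]
    intro h
    have h0 : y = 0 := by
      have h1 : ((y : ℤ) : K) = 0 := h
      exact_mod_cast h1
    exact hy (h0 ▸ p.zero_mem)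
  obtain ⟨A, hA, hloc⟩ := IsLocalRing.exists_factor_valuationRing
    (IsLocalization.lift (S := Localization.AtPrime p) hu)
  refine ⟨A, ?_⟩
  have hval : IsLocalization.lift (S := Localization.AtPrime p) hu
      (algebraMap ℤ (Localization.AtPrime p) 2) = (2 : K) := by
    rw [IsLocalization.lift_eq]
    simp
  have hmem : (2 : K) ∈ A := hval ▸ hA _
  refine lt_of_le_of_ne ((A.valuation_le_one_iff 2).mpr hmem) fun h1 => ?_
  -- If 2 were a unit of `A`, locality of the map would make 2 a unit of `ℤ_(2)`.
  have h2 : IsUnit (⟨2, hmem⟩ : A) := (A.valuation_eq_one_iff ⟨2, hmem⟩).mpr h1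
  have h3 : IsUnit ((IsLocalization.lift (S := Localization.AtPrime p) hu).codRestrict
      A.toSubring hA (algebraMap ℤ (Localization.AtPrime p) 2)) := by
    rw [show (IsLocalization.lift (S := Localization.AtPrime p) hu).codRestrict A.toSubring hA
      (algebraMap ℤ (Localization.AtPrime p) 2) = ⟨2, hmem⟩ from Subtype.ext hval]
    exact h2
  have h4 := hloc.map_nonunit _ h3
  rw [IsLocalization.AtPrime.isUnit_to_map_iff (Localization.AtPrime p) p] at h4
  exact h4 (Ideal.mem_span_singleton_self 2)

variable {Γ : Type*} [LinearOrderedCommGroupWithZero Γ]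

/-- The valuation of the first affine coordinate. -/
def xVal (v : Valuation ℂ Γ) {k : Fin 5} : (E k).Point → Γ
  | .zero => 0
  | .some x _ _ => v x

theorem val_sub_of_lt {v : Valuation ℂ Γ} {x c : ℂ} (h : v c < v x) : v (x - c) = v x :=
  Valuation.map_sub_eq_of_lt_left v h

/-- Here `1 < v x` means that `x` is not integral. Then `x` dominates 1 and `root k`, and the
duplication formula reduces to `v X * v 4 = v x` with `v 4 < 1`. Since `xVal` is 0 at `O`, the
hypothesis excludes `O`, and the conclusion excludes it for the double. -/
theorem xVal_double_lt {v : Valuation ℂ Γ} (h2 : v 2 < 1) {k : Fin 5} (hr : v (root k) ≤ 1)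
    {P : (E k).Point} (hP : 1 < xVal v P) : xVal v P < xVal v ((2 : ℤ) • P) := by
  match P, hP with
  | .zero, hP => exact absurd hP (not_lt_of_ge zero_le)
  | .some x y h, hP =>
    change 1 < v x at hP
    have e := congrArg v (E_nonsingular_iff.mp h)
    have h1 : v (x - 1) = v x := val_sub_of_lt (by rwa [map_one])
    have h3 : v (x - root k) = v x := val_sub_of_lt (hr.trans_lt hP)
    have hx2 : v x ≤ v (x ^ 2) := by
      rw [map_pow, sq]
      exact le_mul_of_one_le_left' hP.le
    have h4 : v (x ^ 2 - root k) = v (x ^ 2) := val_sub_of_lt (hr.trans_lt (hP.trans_le hx2))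
    have hx0 : v x ≠ 0 := (zero_lt_one.trans hP).ne'
    rw [map_mul, map_mul, h1, h3, map_pow] at e
    have hy : y ≠ 0 := by
      rintro rfl
      simp [hx0] at e
    obtain ⟨X, Y, h', eq, hX⟩ := E_double h hy
    rw [eq]
    change v x < v X
    have hX := congrArg v hX
    rw [map_mul, map_mul, map_pow, map_pow, h4, e, map_pow] at hX
    have hX' : v X * v 4 = v x := by
      have : v x * v x * v x ≠ 0 := by simp [hx0]
      apply mul_right_cancel₀ this
      rw [mul_assoc, hX]
      simp only [pow_succ, pow_zero, one_mul, mul_assoc]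
    have h20 : v 2 ≠ 0 := by simp
    have hv4 : v 4 < 1 := by
      rw [show (4 : ℂ) = 2 * 2 by norm_num, map_mul]
      exact mul_lt_one_of_nonneg_of_lt_one_left zero_le h2 h2.le
    rw [← hX']
    refine mul_lt_of_lt_one_right ?_ hv4
    rw [zero_lt_iff]
    rintro h0
    rw [h0, zero_mul] at hX'
    exact hx0 hX'.symm

/-- The points `2^n P` have strictly increasing `xVal`, so they are pairwise distinct. -/
theorem not_isOfFinAddOrder_of_one_lt_xVal {v : Valuation ℂ Γ} (h2 : v 2 < 1) {k : Fin 5}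
    (hr : v (root k) ≤ 1) {P : (E k).Point} (hP : 1 < xVal v P) : ¬ IsOfFinAddOrder P := by
  intro hfin
  have hone : ∀ n : ℕ, 1 < xVal v ((2 : ℤ) ^ n • P) := by
    intro n
    induction n with
    | zero => simpa using hP
    | succ n ih =>
      rw [pow_succ', mul_smul]
      exact ih.trans (xVal_double_lt h2 hr ih)
  have hmono : StrictMono fun n : ℕ => xVal v ((2 : ℤ) ^ n • P) := by
    refine strictMono_nat_of_lt_succ fun n => ?_
    rw [pow_succ', mul_smul]
    exact xVal_double_lt h2 hr (hone n)
  have hinj : Function.Injective fun n : ℕ => (2 : ℤ) ^ n • P :=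
    fun a b hab => hmono.injective (congrArg (xVal v) hab)
  have hsub : Set.range (fun n : ℕ => (2 : ℤ) ^ n • P) ⊆ AddSubgroup.zmultiples P := by
    rintro _ ⟨n, rfl⟩
    exact AddSubgroup.zsmul_mem_zmultiples _ _
  exact Set.infinite_range_of_injective hinj ((finite_zmultiples.mpr hfin).subset hsub)

/-- The numerator of the duplication formula is a unit, while `4 y²` has valuation less than 1.
Hence the double has a non-integral first coordinate. -/
theorem not_isOfFinAddOrder_of_val {v : Valuation ℂ Γ} (h2 : v 2 < 1) {k : Fin 5}
    (hr : v (root k) ≤ 1) {x y : ℂ} (h : (E k).Nonsingular x y) (hx : v x ≤ 1)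
    (hxr : v (x ^ 2 - root k) = 1) (hy : y ≠ 0) : ¬ IsOfFinAddOrder (Point.some x y h) := by
  obtain ⟨X, Y, h', eq, hX⟩ := E_double h hy
  intro hfin
  refine not_isOfFinAddOrder_of_one_lt_xVal h2 hr (P := (2 : ℤ) • Point.some x y h) ?_ hfin.zsmul
  rw [eq]
  change 1 < v X
  have hX := congrArg v hX
  have e := congrArg v (E_nonsingular_iff.mp h)
  have hs : ∀ c : ℂ, v c ≤ 1 → v (x - c) ≤ 1 := fun c hc => (v.map_sub _ _).trans (max_le hx hc)
  have hy1 : v (y ^ 2) ≤ 1 := by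
    rw [e, map_mul, map_mul]
    exact mul_le_one' (mul_le_one' hx (hs 1 (by simp))) (hs _ hr)
  rw [map_mul, map_mul, map_pow _ (x ^ 2 - root k), hxr, one_pow] at hX
  have hv4 : v 4 < 1 := by
    rw [show (4 : ℂ) = 2 * 2 by norm_num, map_mul]
    exact mul_lt_one_of_nonneg_of_lt_one_left zero_le h2 h2.le
  by_contra! hle
  have : v X * (v 4 * v (y ^ 2)) < 1 :=
    mul_lt_one_of_nonneg_of_lt_one_right hle zero_le
      (mul_lt_one_of_nonneg_of_lt_one_left zero_le hv4 hy1)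
  exact this.ne hX

/-! ### The maps `ν_k` under sign changes and complex conjugation of the coordinates -/

theorem nuX_congr (k : Fin 5) {x y : Fin 5 → ℂ} (h : ∀ i, x i ^ 2 = y i ^ 2) :
    nuX k x = nuX k y := by
  fin_cases k <;> simp [nuX, h]

theorem nuX_conj (k : Fin 5) (x : Fin 5 → ℂ) : nuX k (fun i => conj (x i)) = conj (nuX k x) := by
  fin_cases k <;> simp [nuX, phi_conj, Complex.conj_ofNat]

/-- The map `ν_k` has real coefficients for `k = 1`, and purely imaginary coefficients in its
second coordinate otherwise. -/
def nuSign (k : Fin 5) : ℂ := if k = 1 then 1 else -1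

theorem nuY_conj (k : Fin 5) (x : Fin 5 → ℂ) :
    nuY k (fun i => conj (x i)) = nuSign k * conj (nuY k x) := by
  fin_cases k <;> simp [nuY, phi_conj, nuSign, Complex.conj_ofNat]

theorem mul_div_sign_pow {e a b c : ℂ} (he : e ^ 2 = 1) :
    c * a / (e * b) ^ 3 = c * e * (a / b ^ 3) := by
  have he0 : e ≠ 0 := by
    rintro rfl
    norm_num at he
  rw [mul_pow, show e ^ 3 = e by linear_combination e * he, mul_div_mul_comm]
  congr 1
  rw [div_eq_iff he0]
  linear_combination -c * he

/-- Three coordinates occur linearly in the numerator and `x_{k-1}` occurs cubed in the denominator.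
Only `x_k` is absent. -/
theorem nuY_mul_sign (k : Fin 5) {e : Fin 5 → ℂ} (he : ∀ i, e i ^ 2 = 1) (x : Fin 5 → ℂ) :
    nuY k (fun i => e i * x i) = (∏ i ∈ Finset.univ.erase k, e i) * nuY k x := by
  have h0 : ∀ {s a b c p q r : ℂ} (i : Fin 5), s = p * q * r * e i →
      p * a * (q * b) * (r * c) / (e i * x i) ^ 3 = s * (a * b * c / x i ^ 3) := by
    intro s a b c p q r i hs
    rw [hs, show p * a * (q * b) * (r * c) = (p * q * r) * (a * b * c) by ring,
      mul_div_sign_pow (he i)]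
  fin_cases k
  · have hp : ∏ i ∈ Finset.univ.erase (0 : Fin 5), e i = e 1 * e 2 * e 3 * e 4 := by
      rw [show Finset.univ.erase (0 : Fin 5) = {1, 2, 3, 4} by decide]
      simp [mul_assoc]
    change I * (e 1 * x 1 * (e 2 * x 2) * (e 3 * x 3) / (e 4 * x 4) ^ 3) =
      (∏ i ∈ Finset.univ.erase (0 : Fin 5), e i) * (I * (x 1 * x 2 * x 3 / x 4 ^ 3))
    rw [hp, h0 4 rfl]
    ring
  · have hp : ∏ i ∈ Finset.univ.erase (1 : Fin 5), e i = e 2 * e 3 * e 4 * e 5 := by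
      rw [show Finset.univ.erase (1 : Fin 5) = {2, 3, 4, 5} by decide]
      simp [mul_assoc]
    change (2 * phi + 1) * (e 2 * x 2 * (e 3 * x 3) * (e 4 * x 4) / (e 5 * x 5) ^ 3) =
      (∏ i ∈ Finset.univ.erase (1 : Fin 5), e i) * ((2 * phi + 1) * (x 2 * x 3 * x 4 / x 5 ^ 3))
    rw [hp, h0 5 rfl]
    ring
  · have hp : ∏ i ∈ Finset.univ.erase (2 : Fin 5), e i = e 3 * e 4 * e 5 * e 1 := by
      rw [show Finset.univ.erase (2 : Fin 5) = {3, 4, 5, 1} by decide]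
      simp [mul_assoc]
    change I * (e 3 * x 3 * (e 4 * x 4) * (e 5 * x 5) / (e 1 * x 1) ^ 3) =
      (∏ i ∈ Finset.univ.erase (2 : Fin 5), e i) * (I * (x 3 * x 4 * x 5 / x 1 ^ 3))
    rw [hp, h0 1 rfl]
    ring
  · have hp : ∏ i ∈ Finset.univ.erase (3 : Fin 5), e i = e 1 * e 4 * e 5 * e 2 := by
      rw [show Finset.univ.erase (3 : Fin 5) = {1, 4, 5, 2} by decide]
      simp [mul_assoc]
    change I * (2 * phi + 1) * (e 1 * x 1 * (e 4 * x 4) * (e 5 * x 5) / (e 2 * x 2) ^ 3) =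
      (∏ i ∈ Finset.univ.erase (3 : Fin 5), e i) *
        (I * (2 * phi + 1) * (x 1 * x 4 * x 5 / x 2 ^ 3))
    rw [hp, h0 2 rfl]
    ring
  · have hp : ∏ i ∈ Finset.univ.erase (4 : Fin 5), e i = e 1 * e 2 * e 5 * e 3 := by
      rw [show Finset.univ.erase (4 : Fin 5) = {1, 2, 5, 3} by decide]
      simp [mul_assoc]
    change I * phi * (e 1 * x 1 * (e 2 * x 2) * (e 5 * x 5) / (e 3 * x 3) ^ 3) =
      (∏ i ∈ Finset.univ.erase (4 : Fin 5), e i) * (I * phi * (x 1 * x 2 * x 5 / x 3 ^ 3))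
    rw [hp, h0 3 rfl]
    ring

/-! ### The signs of the vertices -/

/-- The sign by which `ν_k` differs at two vertices of the same parity. -/
def vertexSign (k : Fin 5) (v : Vertex) : ℤ := if v k = v (k + 2) then 1 else -1

/-- `1` for vertices at even distance from `(1,1,1,1,1)`, and `-1` for the others. -/
def paritySign (v : Vertex) : ℤ := if ∑ l, v l = 1 then 1 else -1

/-- The sign by which `ν_k` differs from a vertex to its neighbour along colour `k + 1`, after
complex conjugation. -/
def conjSign (k : Fin 5) : ℤ := if k = 1 ∨ k = 4 then -1 else 1

/-- The signs `sgn i j` as integers. -/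
def sgnInt (i j : Fin 5) : ℤ :=
  (![![-1, -1, -1, -1, 1], ![1, 1, 1, 1, 1], ![1, -1, -1, -1, -1], ![-1, -1, 1, 1, 1],
    ![-1, -1, -1, 1, 1]] : Fin 5 → Fin 5 → ℤ) i j

theorem sgn_eq_cast (i j : Fin 5) : sgn i j = sgnInt i j := by
  fin_cases i <;> fin_cases j <;> simp [sgn, sgnInt]

theorem prod_sgnInt_erase (k j : Fin 5) : ∏ i ∈ Finset.univ.erase k, sgnInt i j =
    (if j = k ∨ j = k + 2 then -1 else 1) * if k = 4 then 1 else -1 := by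
  revert k j
  decide

/-- The sign common to all colours occurs once per zero coordinate of `v`, so it only sees the
parity of `v`. The extra signs for the colours `k` and `k + 2` cancel exactly when `v k = v (k +
2)`. -/
theorem prod_ite_sign (k : Fin 5) (v : Vertex) :
    (∏ j, if v j = 0 then ((if j = k ∨ j = k + 2 then -1 else 1) * if k = 4 then 1 else -1 : ℤ)
      else 1) = vertexSign k v * if ∑ l, v l = 1 then 1 else if k = 4 then 1 else -1 := by
  have h2 : ∀ a : ZMod 2, a = 0 ∨ a = 1 := by decide
  simp only [vertexSign, Fin.prod_univ_five, Fin.sum_univ_five]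
  rcases h2 (v 0) with h0 | h0 <;> rcases h2 (v 1) with h1 | h1 <;>
    rcases h2 (v 2) with h2' | h2' <;> rcases h2 (v 3) with h3 | h3 <;>
    rcases h2 (v 4) with h4 | h4 <;> fin_cases k <;> simp [h0, h1, h2', h3, h4] <;> decide

/-- For black vertices the sign is split so that `nuSign` cancels the factor produced by `nuY_conj`,
leaving `conjSign`. -/
theorem prod_eps_erase (k : Fin 5) (v : Vertex) : ∏ i ∈ Finset.univ.erase k, eps v i =
    vertexSign k v * if ∑ l, v l = 1 then 1 else nuSign k * conjSign k := by
  have h : ∏ i ∈ Finset.univ.erase k, eps v i =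
      ((∏ j, if v j = 0 then ∏ i ∈ Finset.univ.erase k, sgnInt i j else 1 : ℤ) : ℂ) := by
    unfold eps
    rw [Finset.prod_comm]
    push_cast
    refine Finset.prod_congr rfl fun j _ => ?_
    split_ifs <;> simp [sgn_eq_cast]
  simp only [h, prod_sgnInt_erase, prod_ite_sign]
  have hk : nuSign k * conjSign k = if k = 4 then 1 else -1 := by
    fin_cases k <;> simp [nuSign, conjSign]
  rw [hk]
  push_cast
  rfl

theorem vertexSign_eq (k : Fin 5) (v : Vertex) : vertexSign k v = 1 ∨ vertexSign k v = -1 := by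
  unfold vertexSign
  split_ifs <;> simp

theorem paritySign_eq (v : Vertex) : paritySign v = 1 ∨ paritySign v = -1 := by
  unfold paritySign
  split_ifs <;> simp

/-! ### Homogeneous coordinates of the face centers -/

theorem zeta_pow_eq_one_iff (m : ℕ) : zeta ^ m = 1 ↔ 10 ∣ m := by
  have h : IsPrimitiveRoot zeta 10 := by
    exact Complex.isPrimitiveRoot_exp 10 (by norm_num)
  exact h.pow_eq_one_iff_dvd m

/-- The coordinates of `f_{j,j+1}(1,1,1,1,1)`. -/
def faceBase (j i : Fin 5) : ℂ := baseCoord i * cs (1 - dWhite j i)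

theorem dWhite_eq_one_iff (j i : Fin 5) : dWhite j i = 1 ↔ i = j + 2 := by
  rw [dWhite, zeta_pow_eq_one_iff]
  revert i j
  decide

/-- A face center lies over a branch point of `π`, where one coordinate vanishes. Hence `ν_k` has
its pole at the centers with `j = k + 2`, and `x_k` vanishes at those with `j = k - 2`. -/
theorem faceBase_eq_zero_iff (j i : Fin 5) : faceBase j i = 0 ↔ i = j + 2 := by
  rw [← dWhite_eq_one_iff]
  constructor
  · intro h
    have h1 := (mul_eq_zero.mp h).resolve_left (baseCoord_ne_zero i)
    have h2 := cs_sq (1 - dWhite j i)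
    rw [h1] at h2
    linear_combination h2
  · intro h
    simp [faceBase, h, cs]

theorem faceBase_sq (j i : Fin 5) : faceBase j i ^ 2 = baseCoord i ^ 2 * (1 - dWhite j i) := by
  rw [faceBase, mul_pow, cs_sq]

/-- Lifts from black corners are therefore conjugate to lifts from white ones, so `faceBase`
describes all face centers up to signs and conjugation. -/
theorem dBlack_eq (j i : Fin 5) : dBlack j i = conj (dWhite j i) := by
  have h1 : ∀ m, conj (zeta ^ m) * zeta ^ m = 1 := fun m => by
    rw [mul_comm, Complex.mul_conj, Complex.normSq_eq_norm_sq, norm_zeta_pow]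
    simp
  rw [dBlack, dWhite, pow_add zeta (2 * (i : ℕ)), map_mul]
  congr 1
  have h2 := h1 (16 - 2 * (j : ℕ))
  have h3 : zeta ^ (2 * (j : ℕ) + 4) * zeta ^ (16 - 2 * (j : ℕ)) = 1 := by
    rw [← pow_add, zeta_pow_eq_one_iff]
    omega
  exact mul_right_cancel₀ (pow_ne_zero _ zeta_ne_zero) (h3.trans h2.symm)

theorem cs_conj {z : ℂ} (h : z.arg ≠ Real.pi) : cs (conj z) = conj (cs z) := by
  unfold cs
  rw [Complex.conj_cpow _ _ h]
  simp [Complex.conj_ofNat]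

theorem arg_one_sub_ne_pi {d : ℂ} (hd : ‖d‖ = 1) : (1 - d).arg ≠ Real.pi := by
  intro h
  have h1 := (Complex.arg_eq_pi_iff.mp h).1
  have h2 := Complex.re_le_norm d
  rw [Complex.sub_re, Complex.one_re] at h1
  linarith

theorem faceCoord_white {v : Vertex} (h : ∑ l, v l = 1) (j : Fin 5) :
    faceCoord j v = fun i => eps v i * faceBase j i := by
  funext i
  simp only [faceCoord, if_pos h, liftPoint, coord_white h, faceBase]
  push_cast
  rw [one_mul, mul_assoc]

theorem faceCoord_black {v : Vertex} (h : ∑ l, v l ≠ 1) (j : Fin 5) :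
    faceCoord j v = fun i => eps v i * conj (faceBase j i) := by
  funext i
  simp only [faceCoord, if_neg h, liftPoint, coord_black h, faceBase, map_mul]
  rw [← cs_conj (arg_one_sub_ne_pi (norm_dWhite j i)), map_sub, map_one, dBlack_eq]
  push_cast
  rw [one_mul, mul_assoc]

/-! ### The values of `ν_k` in coordinates -/

theorem nuX_eps_mul (k : Fin 5) (v : Vertex) (w : Fin 5 → ℂ) :
    nuX k (fun i => eps v i * w i) = nuX k w :=
  nuX_congr k fun i => by rw [mul_pow, eps_sq, one_mul]

theorem nuY_eps_mul_white (k : Fin 5) {v : Vertex} (h : ∑ l, v l = 1) (w : Fin 5 → ℂ) :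
    nuY k (fun i => eps v i * w i) = vertexSign k v * nuY k w := by
  rw [nuY_mul_sign k (eps_sq v), prod_eps_erase, if_pos h, mul_one]

theorem nuY_eps_mul_black (k : Fin 5) {v : Vertex} (h : ∑ l, v l ≠ 1) (w : Fin 5 → ℂ) :
    nuY k (fun i => eps v i * conj (w i)) = vertexSign k v * (conjSign k * conj (nuY k w)) := by
  rw [nuY_mul_sign k (eps_sq v), prod_eps_erase, if_neg h, nuY_conj]
  have : nuSign k * nuSign k = 1 := by
    unfold nuSign
    split_ifs <;> norm_num
  linear_combination (vertexSign k v * conjSign k * conj (nuY k w) : ℂ) * this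

/-- The first affine coordinate of `e^k_∞`. -/
def xInf : Fin 5 → ℂ :=
  ![1 + zeta ^ 2, 1 - zeta - zeta ^ 3, 1 + zeta ^ 2, zeta + zeta ^ 3, 1 - zeta - zeta ^ 3]

/-- The first affine coordinate of `e^k_4`. -/
def xFour : Fin 5 → ℂ := ![phi + 1, -phi, phi + 1, phi + 1, -phi]

/-- The first affine coordinate of `2 e^k_4`. -/
def xTwoFour : Fin 5 → ℂ := ![phi, 0, phi, 1, 0]

/-- The first affine coordinate of `e^k_2`. -/
def xTwo : Fin 5 → ℂ := ![1, 1, 1, 0, 1]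

/-- The first affine coordinate of `2 e^k_4 + e^k_2`. -/
def xThird : Fin 5 → ℂ := ![0, phi + 1, 0, -phi, phi + 1]

/-- The second affine coordinate of `e^k_∞`. -/
def yInf : Fin 5 → ℂ :=
  ![sqrtPhi * zeta ^ 8, I * phi ^ 2 * zeta ^ 3, sqrtPhi * zeta ^ 8, phi ^ 2 * zeta ^ 3,
    I * phi ^ 2 * zeta ^ 3]

theorem baseCoord_sq : baseCoord 0 ^ 2 = zeta ^ 6 * phi ∧ baseCoord 1 ^ 2 = 1 ∧
    baseCoord 2 ^ 2 = zeta ^ 4 * phi ∧ baseCoord 3 ^ 2 = zeta ^ 8 ∧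
    baseCoord 4 ^ 2 = zeta ^ 7 := by
  have h5 := zeta_five
  have hs := sqrtPhi_sq
  have hI := I_sq
  refine ⟨?_, ?_, ?_, ?_, ?_⟩ <;> simp only [baseCoord] <;> grind

theorem nuX_baseCoord (k : Fin 5) : nuX k baseCoord = xInf k := by
  have h5 := zeta_five
  have hm := zeta_min
  have hp := phi_eq
  have hz := zeta_ne_zero
  have hp0 := phi_ne_zero
  obtain ⟨s0, s1, s2, s3, s4⟩ := baseCoord_sq
  fin_cases k
  · change -(baseCoord 0 ^ 2 / baseCoord 4 ^ 2) + phi + 1 = 1 + zeta ^ 2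
    rw [s0, s4]
    field_simp
    grind
  · change -(2 * phi + 1) * (baseCoord 1 ^ 2 / baseCoord 0 ^ 2) - phi = 1 - zeta - zeta ^ 3
    rw [s0, s1]
    field_simp
    grind
  · change baseCoord 2 ^ 2 / baseCoord 1 ^ 2 + phi + 1 = 1 + zeta ^ 2
    rw [s2, s1]
    grind
  · change (2 * phi + 1) * (baseCoord 3 ^ 2 / baseCoord 2 ^ 2) + phi + 1 = zeta + zeta ^ 3
    rw [s2, s3]
    field_simp
    grind
  · change (phi + 1) * (baseCoord 4 ^ 2 / baseCoord 3 ^ 2) - phi = 1 - zeta - zeta ^ 3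
    rw [s4, s3]
    field_simp
    grind

/-- The leading coefficient of the first coordinate of `ν_k` as a polynomial in
`x_k² / x_{k-1}²`. -/
def nuLead : Fin 5 → ℂ := ![-1, -(2 * phi + 1), 1, 2 * phi + 1, phi + 1]

/-- The constant term is the value at `x_k = 0`, which is the first coordinate of `e^k_4`. The other
values can then be checked without denominators. -/
theorem nuX_eq_lead (k : Fin 5) (x : Fin 5 → ℂ) :
    nuX k x = nuLead k * (x k ^ 2 / x (k - 1) ^ 2) + xFour k := by
  fin_cases k <;> simp [nuX, nuLead, xFour] <;>
    first | ring1 | (ring_nf; rfl)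

theorem nuX_eq_of_lead (k : Fin 5) {x : Fin 5 → ℂ} {t : ℂ} (hx : x (k - 1) ≠ 0)
    (h : nuLead k * x k ^ 2 = (t - xFour k) * x (k - 1) ^ 2) : nuX k x = t := by
  rw [nuX_eq_lead, mul_div_assoc', h, mul_div_cancel_right₀ _ (pow_ne_zero 2 hx),
    sub_add_cancel]

theorem nuX_faceBase_four (k : Fin 5) : nuX k (faceBase (k - 2)) = xFour k := by
  rw [nuX_eq_lead, (faceBase_eq_zero_iff (k - 2) k).mpr (by revert k; decide)]
  simp

theorem faceBase_sub_one_ne_zero {k j : Fin 5} (h : j ≠ k + 2) : faceBase j (k - 1) ≠ 0 := by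
  rw [Ne, faceBase_eq_zero_iff]
  revert k j
  decide

theorem nuX_faceBase_twoFour (k : Fin 5) : nuX k (faceBase (k - 1)) = xTwoFour k := by
  refine nuX_eq_of_lead k (faceBase_sub_one_ne_zero (by revert k; decide)) ?_
  have h5 := zeta_five
  have hm := zeta_min
  have hp := phi_eq
  obtain ⟨s0, s1, s2, s3, s4⟩ := baseCoord_sq
  rw [faceBase_sq, faceBase_sq, dWhite, dWhite]
  fin_cases k <;> simp [nuLead, xFour, xTwoFour, show (-1 : Fin 5) = 4 from rfl,
    s0, s1, s2, s3, s4] <;> grind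

theorem nuX_faceBase_two (k : Fin 5) : nuX k (faceBase k) = xTwo k := by
  refine nuX_eq_of_lead k (faceBase_sub_one_ne_zero (by revert k; decide)) ?_
  have h5 := zeta_five
  have hm := zeta_min
  have hp := phi_eq
  obtain ⟨s0, s1, s2, s3, s4⟩ := baseCoord_sq
  rw [faceBase_sq, faceBase_sq, dWhite, dWhite]
  fin_cases k <;> simp [nuLead, xFour, xTwo, show (-1 : Fin 5) = 4 from rfl,
    s0, s1, s2, s3, s4] <;> grind

theorem nuX_faceBase_third (k : Fin 5) : nuX k (faceBase (k + 1)) = xThird k := by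
  refine nuX_eq_of_lead k (faceBase_sub_one_ne_zero (by revert k; decide)) ?_
  have h5 := zeta_five
  have hm := zeta_min
  have hp := phi_eq
  obtain ⟨s0, s1, s2, s3, s4⟩ := baseCoord_sq
  rw [faceBase_sq, faceBase_sq, dWhite, dWhite]
  fin_cases k <;> simp [nuLead, xFour, xThird, show (-1 : Fin 5) = 4 from rfl,
    s0, s1, s2, s3, s4] <;> grind

theorem nuY_eq_zero (k : Fin 5) {x : Fin 5 → ℂ} {i : Fin 5} (hk : i ≠ k) (hk' : i ≠ k - 1)
    (h : x i = 0) : nuY k x = 0 := by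
  have h5 : ∀ i : Fin 5, i = 0 ∨ i = 1 ∨ i = 2 ∨ i = 3 ∨ i = 4 := by decide
  rcases h5 k with rfl | rfl | rfl | rfl | rfl <;> rcases h5 i with rfl | rfl | rfl | rfl | rfl <;>
    first
      | exact absurd rfl hk
      | exact absurd rfl hk'
      | simp [nuY, h]

/-- The vanishing coordinate `x_{j+2}` is neither `x_k` nor `x_{k-1}`, so it is a factor of the
numerator. These three families of centers therefore map to 2-torsion points. -/
theorem nuY_faceBase (k j : Fin 5) (h1 : j ≠ k - 2) (h2 : j ≠ k + 2) : nuY k (faceBase j) = 0 := by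
  refine nuY_eq_zero k (i := j + 2) ?_ ?_ ((faceBase_eq_zero_iff j _).mpr rfl)
  · clear h2
    revert k j
    decide
  · clear h1
    revert k j
    decide

theorem nuY_baseCoord (k : Fin 5) : nuY k baseCoord = yInf k := by
  have h5 := zeta_five
  have hm := zeta_min
  have hp := phi_eq
  have hz := zeta_ne_zero
  have hs := sqrtPhi_sq
  have hI := I_sq
  have hs0 : sqrtPhi ≠ 0 := fun h => phi_ne_zero (by rw [← hs, h]; norm_num)
  fin_cases k
  · change I * (1 * (zeta ^ 2 * sqrtPhi) * zeta ^ 9 / (I * zeta ^ 6) ^ 3) = sqrtPhi * zeta ^ 8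
    field_simp
    grind
  · change (2 * phi + 1) * (zeta ^ 2 * sqrtPhi * zeta ^ 9 * (I * zeta ^ 6) /
      (zeta ^ 8 * sqrtPhi) ^ 3) = I * phi ^ 2 * zeta ^ 3
    field_simp
    grind
  · change I * (zeta ^ 9 * (I * zeta ^ 6) * (zeta ^ 8 * sqrtPhi) / 1 ^ 3) = sqrtPhi * zeta ^ 8
    grind
  · change I * (2 * phi + 1) * (1 * (I * zeta ^ 6) * (zeta ^ 8 * sqrtPhi) /
      (zeta ^ 2 * sqrtPhi) ^ 3) = phi ^ 2 * zeta ^ 3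
    field_simp
    grind
  · change I * phi * (1 * (zeta ^ 2 * sqrtPhi) * (zeta ^ 8 * sqrtPhi) / (zeta ^ 9) ^ 3) =
      I * phi ^ 2 * zeta ^ 3
    field_simp
    grind

/-! ### The points `ν_k(P)` for the vertices and face centers `P` -/

theorem nu_eq_some {k : Fin 5} {x : X} {a b : ℂ} (hab : (E k).Nonsingular a b)
    (hx : (x : Fin 5 → ℂ) (k - 1) ≠ 0) (ha : nuX k x = a) (hb : nuY k x = b) :
    nu k x = Point.some a b hab := by
  subst ha hb
  exact dif_neg hx

theorem E_nonsingular_sign_mul {k : Fin 5} {x y : ℂ} (h : (E k).Nonsingular x y) {s : ℤ}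
    (hs : s = 1 ∨ s = -1) : (E k).Nonsingular x (s * y) := by
  rw [E_nonsingular_iff] at h ⊢
  rcases hs with rfl | rfl <;> push_cast <;> linear_combination h

theorem E_sign_smul {k : Fin 5} {x y : ℂ} (h : (E k).Nonsingular x y) {s : ℤ}
    (hs : s = 1 ∨ s = -1) :
    s • Point.some x y h = Point.some x (s * y) (E_nonsingular_sign_mul h hs) := by
  rcases hs with rfl | rfl
  · simp
  · rw [neg_one_zsmul, E_neg_some h (by simpa using E_nonsingular_sign_mul h (Or.inr rfl))]
    simp

theorem E_nonsingular_conj {k : Fin 5} {x y : ℂ} (h : (E k).Nonsingular x y) :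
    (E k).Nonsingular (conj x) (conj y) := by
  rw [E_nonsingular_iff] at h ⊢
  have hr : conj (root k) = root k := by
    fin_cases k <;> simp [root, phi_conj]
  have := congrArg conj h
  simpa only [map_pow, map_mul, map_sub, map_one, hr] using this

theorem sum_one_vertex : ∑ l, (1 : Vertex) l = 1 := by decide

theorem eps_one (i : Fin 5) : eps 1 i = 1 := by simp [eps]

theorem eps_ne_zero (v : Vertex) (i : Fin 5) : eps v i ≠ 0 := by
  intro h
  have := eps_sq v i
  rw [h] at this
  norm_num at this

theorem conjSign_eq (k : Fin 5) : conjSign k = 1 ∨ conjSign k = -1 := by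
  unfold conjSign
  split_ifs <;> simp

/-- The second affine coordinate of `e^k_4`. -/
def yFour (k : Fin 5) : ℂ := nuY k (faceBase (k - 2))

theorem faceBase_mem (j : Fin 5) : faceBase j ∈ X := by
  have h := (face_spec j 1).1
  rw [faceCoord_white sum_one_vertex] at h
  simpa only [eps_one, one_mul] using h

theorem nonsingular_inf (k : Fin 5) : (E k).Nonsingular (xInf k) (yInf k) := by
  have := nu_nonsingular k ⟨baseCoord, mem_X_of_onL (fun h => baseCoord_ne_zero 0 (congrFun h 0))
    base_onL⟩ (baseCoord_ne_zero _)
  rwa [nuX_baseCoord, nuY_baseCoord] at this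

theorem nonsingular_four (k : Fin 5) : (E k).Nonsingular (xFour k) (yFour k) := by
  have := nu_nonsingular k ⟨faceBase (k - 2), faceBase_mem _⟩
    (faceBase_sub_one_ne_zero (by revert k; decide))
  rwa [nuX_faceBase_four] at this

theorem nonsingular_twoFour (k : Fin 5) : (E k).Nonsingular (xTwoFour k) 0 := by
  rw [E_nonsingular_iff]
  fin_cases k <;> simp [xTwoFour, root]

theorem nonsingular_two (k : Fin 5) : (E k).Nonsingular (xTwo k) 0 := by
  rw [E_nonsingular_iff]
  fin_cases k <;> simp [xTwo, root]

theorem nonsingular_third (k : Fin 5) : (E k).Nonsingular (xThird k) 0 := by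
  rw [E_nonsingular_iff]
  fin_cases k <;> simp [xThird, root]

theorem conj_eq_of_sq_nonneg {y : ℂ} {c : ℝ} (hc : 0 ≤ c) (h : y ^ 2 = c) : conj y = y := by
  rw [Complex.conj_eq_iff_im]
  have hre := congrArg Complex.re h
  have him := congrArg Complex.im h
  simp only [sq, Complex.mul_re, Complex.mul_im, Complex.ofReal_re, Complex.ofReal_im] at hre him
  by_contra h0
  have h1 : y.re = 0 := by
    have : y.re * y.im = 0 := by linarith
    exact (mul_eq_zero.mp this).resolve_right h0
  rw [h1] at hre
  have := mul_self_pos.mpr h0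
  linarith

theorem conj_eq_neg_of_sq_nonpos {y : ℂ} {c : ℝ} (hc : c ≤ 0) (h : y ^ 2 = c) :
    conj y = -y := by
  have h1 := conj_eq_of_sq_nonneg (y := I * y) (neg_nonneg.mpr hc) (by
    push_cast
    rw [mul_pow, I_sq, h]
    ring)
  rw [map_mul, Complex.conj_I] at h1
  apply mul_left_cancel₀ I_ne_zero
  linear_combination -h1

/-- The square of `yFour k` is real by the curve equation. It is positive where `conjSign k = 1` and
negative where `conjSign k = -1`. So the colour of the corner from which a center is reached does
not affect its image. -/
theorem conjSign_mul_conj_yFour (k : Fin 5) : conjSign k * conj (yFour k) = yFour k := by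
  have h := E_nonsingular_iff.mp (nonsingular_four k)
  have hp := Real.goldenRatio_pos
  have pos : ∀ c : ℝ, 0 ≤ c → yFour k ^ 2 = c → conjSign k = 1 →
      conjSign k * conj (yFour k) = yFour k := fun c hc h hk => by
    rw [conj_eq_of_sq_nonneg hc h, hk]
    simp
  have neg : ∀ c : ℝ, 0 ≤ c → yFour k ^ 2 = (-c : ℝ) → conjSign k = -1 →
      conjSign k * conj (yFour k) = yFour k := fun c hc h hk => by
    rw [conj_eq_neg_of_sq_nonpos (neg_nonpos.mpr hc) h, hk]
    simp
  have k5 : ∀ k : Fin 5, k = 0 ∨ k = 1 ∨ k = 2 ∨ k = 3 ∨ k = 4 := by decide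
  rcases k5 k with rfl | rfl | rfl | rfl | rfl
  · refine pos ((Real.goldenRatio + 1) * Real.goldenRatio) (by positivity) ?_ rfl
    rw [h]
    simp [xFour, root, phi]
  · refine neg (Real.goldenRatio * (Real.goldenRatio + 1) * (2 * Real.goldenRatio + 1))
      (by positivity) ?_ rfl
    rw [h]
    simp [xFour, root, phi]
    ring
  · refine pos ((Real.goldenRatio + 1) * Real.goldenRatio) (by positivity) ?_ rfl
    rw [h]
    simp [xFour, root, phi]
  · refine pos ((Real.goldenRatio + 1) * Real.goldenRatio * (2 * Real.goldenRatio + 1))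
      (by positivity) ?_ rfl
    rw [h]
    change (phi + 1) * (phi + 1 - 1) * (phi + 1 - -phi) = _
    unfold phi
    push_cast
    ring
  · refine neg (Real.goldenRatio * (Real.goldenRatio + 1) * (2 * Real.goldenRatio + 1))
      (by positivity) ?_ rfl
    rw [h]
    simp [xFour, root, phi]
    ring

namespace Embedding

theorem eInf_eq (k : Fin 5) :
    hypercubeEmbedding.eInf k = Point.some (xInf k) (yInf k) (nonsingular_inf k) := by
  have hc : coord 1 = baseCoord := hypercubeEmbedding.vertex_base
  refine nu_eq_some _ (coord_ne_zero 1 (k - 1)) ?_ ?_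
  · change nuX k (coord 1) = _
    rw [hc, nuX_baseCoord]
  · change nuY k (coord 1) = _
    rw [hc, nuY_baseCoord]

theorem faceCoord_ne_zero {k j : Fin 5} (h : j ≠ k + 2) (v : Vertex) :
    faceCoord j v (k - 1) ≠ 0 := by
  by_cases hv : ∑ l, v l = 1
  · rw [faceCoord_white hv]
    exact mul_ne_zero (eps_ne_zero _ _) (faceBase_sub_one_ne_zero h)
  · rw [faceCoord_black hv]
    exact mul_ne_zero (eps_ne_zero _ _) ((map_ne_zero _).mpr (faceBase_sub_one_ne_zero h))

theorem nuX_faceCoord (k j : Fin 5) (v : Vertex)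
    (h : conj (nuX k (faceBase j)) = nuX k (faceBase j)) :
    nuX k (faceCoord j v) = nuX k (faceBase j) := by
  by_cases hv : ∑ l, v l = 1
  · rw [faceCoord_white hv, nuX_eps_mul]
  · rw [faceCoord_black hv, nuX_eps_mul, nuX_conj, h]

theorem nuY_faceCoord (k j : Fin 5) (v : Vertex)
    (h : conjSign k * conj (nuY k (faceBase j)) = nuY k (faceBase j)) :
    nuY k (faceCoord j v) = vertexSign k v * nuY k (faceBase j) := by
  by_cases hv : ∑ l, v l = 1
  · rw [faceCoord_white hv, nuY_eps_mul_white k hv]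
  · rw [faceCoord_black hv, nuY_eps_mul_black k hv, h]

theorem nu_faceCenter_four (k : Fin 5) (v : Vertex) :
    nu k (hypercubeEmbedding.faceCenter (k - 2) v) =
      vertexSign k v • Point.some (xFour k) (yFour k) (nonsingular_four k) := by
  rw [E_sign_smul _ (vertexSign_eq k v)]
  refine nu_eq_some _ (faceCoord_ne_zero (by revert k; decide) v) ?_
    (nuY_faceCoord k (k - 2) v (conjSign_mul_conj_yFour k))
  rw [← nuX_faceBase_four]
  refine nuX_faceCoord k (k - 2) v ?_
  rw [nuX_faceBase_four]
  fin_cases k <;> simp [xFour, phi_conj]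

theorem eFour_eq (k : Fin 5) :
    hypercubeEmbedding.eFour k = Point.some (xFour k) (yFour k) (nonsingular_four k) := by
  have h := nu_faceCenter_four k 1
  rw [show vertexSign k 1 = 1 from if_pos rfl, one_zsmul] at h
  exact h

theorem nu_faceCenter_of_two_torsion {k j : Fin 5} {t : ℂ} (h1 : j ≠ k - 2) (h2 : j ≠ k + 2)
    (ht : nuX k (faceBase j) = t) (ht' : conj t = t) (hn : (E k).Nonsingular t 0) (v : Vertex) :
    nu k (hypercubeEmbedding.faceCenter j v) = Point.some t 0 hn := by
  subst ht
  have hY := nuY_faceBase k j h1 h2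
  refine nu_eq_some _ (faceCoord_ne_zero h2 v) (nuX_faceCoord k j v ht') ?_
  have := nuY_faceCoord k j v (by simp [hY])
  rw [hY, mul_zero] at this
  exact this

theorem nu_faceCenter_twoFour (k : Fin 5) (v : Vertex) :
    nu k (hypercubeEmbedding.faceCenter (k - 1) v) =
      Point.some (xTwoFour k) 0 (nonsingular_twoFour k) := by
  refine nu_faceCenter_of_two_torsion ?_ ?_ (nuX_faceBase_twoFour k) ?_ _ v
  · revert k; decide
  · revert k; decide
  · fin_cases k <;> simp [xTwoFour, phi_conj]

theorem nu_faceCenter_two (k : Fin 5) (v : Vertex) :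
    nu k (hypercubeEmbedding.faceCenter k v) = Point.some (xTwo k) 0 (nonsingular_two k) := by
  refine nu_faceCenter_of_two_torsion ?_ ?_ (nuX_faceBase_two k) ?_ _ v
  · revert k; decide
  · revert k; decide
  · fin_cases k <;> simp [xTwo]

theorem nu_faceCenter_third (k : Fin 5) (v : Vertex) :
    nu k (hypercubeEmbedding.faceCenter (k + 1) v) =
      Point.some (xThird k) 0 (nonsingular_third k) := by
  refine nu_faceCenter_of_two_torsion ?_ ?_ (nuX_faceBase_third k) ?_ _ v
  · revert k; decide
  · revert k; decide
  · fin_cases k <;> simp [xThird, phi_conj]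

theorem eTwo_eq (k : Fin 5) :
    hypercubeEmbedding.eTwo k = Point.some (xTwo k) 0 (nonsingular_two k) :=
  nu_faceCenter_two k 1

theorem nu_faceCenter_pole (k : Fin 5) (v : Vertex) :
    nu k (hypercubeEmbedding.faceCenter (k + 2) v) = 0 := by
  have h0 : faceBase (k + 2) (k - 1) = 0 :=
    (faceBase_eq_zero_iff _ _).mpr (by revert k; decide)
  refine dif_pos ?_
  change faceCoord (k + 2) v (k - 1) = 0
  by_cases hv : ∑ l, v l = 1
  · simp [faceCoord_white hv, h0]
  · simp [faceCoord_black hv, h0]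

theorem xTwo_add_xThird (k : Fin 5) : xTwoFour k + xTwo k + xThird k = 1 + root k := by
  fin_cases k <;> simp [xTwoFour, xTwo, xThird, root] <;> ring

theorem xTwoFour_ne_xTwo (k : Fin 5) : xTwoFour k ≠ xTwo k := by
  fin_cases k <;> simp [xTwoFour, xTwo, sub_ne_zero.mp phi_sub_one_ne_zero]

/-- Duplication involves only `y²`, which the curve equation gives; no choice of square root enters.
The resulting first coordinate is a root of the cubic, which forces `Y = 0`. -/
theorem two_eFour (k : Fin 5) : (2 : ℤ) • hypercubeEmbedding.eFour k =
    Point.some (xTwoFour k) 0 (nonsingular_twoFour k) := by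
  have hp := phi_sq
  have h := E_nonsingular_iff.mp (nonsingular_four k)
  have hp0 := phi_ne_zero
  have hp1 := phi_add_one_ne_zero
  have hp2 := phi_sub_one_ne_zero
  have hp3 : 2 * phi + 1 ≠ 0 := by
    rw [show 2 * phi + 1 = phi * phi ^ 2 by linear_combination (-1 - phi) * hp]
    exact mul_ne_zero hp0 (pow_ne_zero _ hp0)
  have hy2 : yFour k ^ 2 ≠ 0 ∧
      (xFour k ^ 2 - root k) ^ 2 = xTwoFour k * (4 * yFour k ^ 2) := by
    rw [h]
    fin_cases k <;> simp [xFour, root, xTwoFour] <;> grind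
  have hy : yFour k ≠ 0 := fun h0 => hy2.1 (by rw [h0]; norm_num)
  obtain ⟨X, Y, h', eq, hX⟩ := E_double (nonsingular_four k) hy
  rw [eFour_eq, eq]
  have hXt : X = xTwoFour k :=
    mul_right_cancel₀ (mul_ne_zero (by norm_num) hy2.1) (hX.trans hy2.2)
  have hY : Y = 0 := by
    have h1 := E_nonsingular_iff.mp h'
    have h2 := E_nonsingular_iff.mp (nonsingular_twoFour k)
    rw [hXt, ← h2] at h1
    exact pow_eq_zero_iff two_ne_zero |>.mp (h1.trans (by norm_num))
  subst hXt hY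
  rfl
end Embedding

/-- Multiplying the relation by 4 kills the torsion part and gives `a = 0`. Doubling what remains
shows that `b` is even. The rest is a relation between `2 Q` and `R`, which are distinct of order 2
and so independent modulo 2. -/
theorem eq_zero_and_dvd_of_zsmul_add_eq_zero {G : Type*} [AddCommGroup G] {P Q R : G}
    (hinf : ¬ IsOfFinAddOrder P) (h4 : (4 : ℤ) • Q = 0) (n4 : (2 : ℤ) • Q ≠ 0)
    (h2 : (2 : ℤ) • R = 0) (n2 : R ≠ 0) (n42 : (2 : ℤ) • Q ≠ R) {a b c : ℤ}
    (h : a • P + b • Q + c • R = 0) : a = 0 ∧ 4 ∣ b ∧ 2 ∣ c := by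
  have ha : a = 0 := by
    have : (4 * a) • P = 0 := by
      have e := congrArg (fun S => (4 : ℤ) • S) h
      simp only [smul_add, smul_zero] at e
      rw [smul_comm 4 b Q, h4, smul_comm 4 c R, show (4 : ℤ) = 2 * 2 by norm_num, mul_smul 2 2 R,
        h2, smul_zero, smul_zero, smul_zero, add_zero, add_zero, ← mul_smul] at e
      exact e
    by_contra ha
    exact hinf (isOfFinAddOrder_iff_zsmul_eq_zero.mpr ⟨4 * a, by omega, this⟩)
  subst ha
  rw [zero_smul, zero_add] at h
  have hb : Even b := by
    rw [← Int.not_odd_iff_even]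
    rintro ⟨m, rfl⟩
    have e := congrArg (fun S => (2 : ℤ) • S) h
    simp only [smul_add, smul_zero] at e
    rw [smul_comm 2 c R, h2, smul_zero, add_zero, ← mul_smul,
      show 2 * (2 * m + 1) = m * 4 + 2 by ring, add_smul, mul_smul, h4, smul_zero, zero_add] at e
    exact n4 e
  obtain ⟨m, rfl⟩ := hb
  rw [← mul_two, mul_smul] at h
  have hT : (2 : ℤ) • ((2 : ℤ) • Q) = 0 := by
    rw [← mul_smul]
    exact h4
  generalize (2 : ℤ) • Q = T at *
  have par : ∀ n : ℤ, ∀ S : G, (2 : ℤ) • S = 0 →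
      (Even n → n • S = 0) ∧ (Odd n → n • S = S) := by
    intro n S hS
    constructor
    · rintro ⟨l, rfl⟩
      rw [← mul_two, mul_smul, hS, smul_zero]
    · rintro ⟨l, rfl⟩
      rw [add_smul, mul_comm, mul_smul, hS, smul_zero, zero_add, one_smul]
  refine ⟨rfl, ?_⟩
  rcases Int.even_or_odd m with hm | hm <;> rcases Int.even_or_odd c with hc | hc
  · obtain ⟨l, rfl⟩ := hm
    obtain ⟨l', rfl⟩ := hc
    constructor <;> omega
  · rw [(par m T hT).1 hm, (par c R h2).2 hc, zero_add] at h
    exact absurd h n2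
  · rw [(par m T hT).2 hm, (par c R h2).1 hc, add_zero] at h
    exact absurd h n4
  · rw [(par m T hT).2 hm, (par c R h2).2 hc, add_eq_zero_iff_eq_neg] at h
    refine absurd ?_ n42
    rw [h, neg_eq_iff_add_eq_zero, ← two_zsmul, h2]

/-! ### The images of the vertices, and the relations among the three basic points. -/

namespace Embedding

theorem conj_xInf (k : Fin 5) : conj (xInf k) =
    ![1 - zeta ^ 3, 1 + zeta ^ 4 + zeta ^ 2, 1 - zeta ^ 3, -zeta ^ 4 - zeta ^ 2,
      1 + zeta ^ 4 + zeta ^ 2] k := by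
  have h5 := zeta_five
  fin_cases k <;> simp [xInf, zeta_conj] <;> grind

theorem conjSign_mul_conj_yInf (k : Fin 5) : conjSign k * conj (yInf k) =
    ![sqrtPhi * zeta ^ 2, -(I * phi ^ 2 * zeta ^ 2), sqrtPhi * zeta ^ 2, -(phi ^ 2 * zeta ^ 2),
      -(I * phi ^ 2 * zeta ^ 2)] k := by
  have h5 := zeta_five
  fin_cases k <;> simp [yInf, conjSign, zeta_conj, sqrtPhi_conj, phi_conj] <;> grind

theorem xInf_ne (k : Fin 5) : xInf k ≠ conj (xInf k) ∧ xInf k ≠ xTwoFour k := by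
  have hm := zeta_min
  have hp := phi_eq
  have hz := zeta_ne_zero
  rw [conj_xInf]
  fin_cases k <;> simp [xInf, xTwoFour] <;> constructor <;> intro h <;> grind

/-- `e^k_∞` and, up to sign, the image of a neighbour of `(1,1,1,1,1)` add up to `2 e^k_4`. -/
theorem eInf_add_conj (k : Fin 5) : Point.some (xInf k) (yInf k) (nonsingular_inf k) +
    Point.some (conj (xInf k)) (conjSign k * conj (yInf k))
      (E_nonsingular_sign_mul (E_nonsingular_conj (nonsingular_inf k)) (conjSign_eq k)) =
    Point.some (xTwoFour k) 0 (nonsingular_twoFour k) := by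
  have h5 := zeta_five
  have hm := zeta_min
  have hp := phi_eq
  refine E_add_collinear _ _ _ (xInf_ne k).1 (xInf_ne k).2 ?_ ?_
  · rw [conjSign_mul_conj_yInf, conj_xInf]
    fin_cases k <;> simp [xInf, yInf, xTwoFour] <;> grind
  · rw [conj_xInf]
    fin_cases k <;> simp [xInf, xTwoFour, root] <;> grind

/-- The image is `±e_∞` for a white vertex and `±(2 e_4 - e_∞)` for a black one. Writing both in
terms of `e_4` and `e_∞ - e_4` isolates the two weights `vertexSign` and `vertexSign * paritySign`.
-/
theorem nu_vertex (k : Fin 5) (v : Vertex) : nu k (hypercubeEmbedding.vertex v) =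
    vertexSign k v • hypercubeEmbedding.eFour k + (vertexSign k v * paritySign v) •
      (hypercubeEmbedding.eInf k - hypercubeEmbedding.eFour k) := by
  have hs := vertexSign_eq k v
  by_cases h : ∑ l, v l = 1
  · have e : (coord v) = fun i => eps v i * baseCoord i := funext fun i => coord_white h i
    rw [show paritySign v = 1 from if_pos h, mul_one, ← zsmul_add, add_sub_cancel, eInf_eq,
      E_sign_smul _ hs]
    refine nu_eq_some _ (coord_ne_zero v (k - 1)) ?_ ?_
    · change nuX k (coord v) = _
      rw [e, nuX_eps_mul, nuX_baseCoord]
    · change nuY k (coord v) = _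
      rw [e, nuY_eps_mul_white k h, nuY_baseCoord]
  · have e : (coord v) = fun i => eps v i * conj (baseCoord i) := funext fun i => coord_black h i
    rw [show paritySign v = -1 from if_neg h, mul_neg_one, neg_zsmul, ← sub_eq_add_neg,
      ← zsmul_sub, sub_sub_eq_add_sub, ← two_zsmul, two_eFour, ← eInf_add_conj, eInf_eq,
      add_sub_cancel_left, E_sign_smul _ hs]
    refine nu_eq_some _ (coord_ne_zero v (k - 1)) ?_ ?_
    · change nuX k (coord v) = _
      rw [e, nuX_eps_mul, nuX_conj, nuX_baseCoord]
    · change nuY k (coord v) = _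
      rw [e, nuY_eps_mul_black k h, nuY_baseCoord]

theorem two_eTwo (k : Fin 5) : (2 : ℤ) • hypercubeEmbedding.eTwo k = 0 := by
  rw [eTwo_eq, E_two_torsion]

theorem four_eFour (k : Fin 5) : (4 : ℤ) • hypercubeEmbedding.eFour k = 0 := by
  rw [show (4 : ℤ) = 2 * 2 by norm_num, mul_smul, two_eFour, E_two_torsion]

theorem eTwo_ne_zero (k : Fin 5) : hypercubeEmbedding.eTwo k ≠ 0 := by
  rw [eTwo_eq]
  exact Point.some_ne_zero _

theorem two_eFour_ne_zero (k : Fin 5) : (2 : ℤ) • hypercubeEmbedding.eFour k ≠ 0 := by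
  rw [two_eFour]
  exact Point.some_ne_zero _

theorem two_eFour_ne_eTwo (k : Fin 5) :
    (2 : ℤ) • hypercubeEmbedding.eFour k ≠ hypercubeEmbedding.eTwo k := by
  rw [two_eFour, eTwo_eq]
  intro h
  injection h with h1
  exact xTwoFour_ne_xTwo k h1

theorem nu_faceCenter_sub_one (k : Fin 5) (v : Vertex) :
    nu k (hypercubeEmbedding.faceCenter (k - 1) v) = (2 : ℤ) • hypercubeEmbedding.eFour k := by
  rw [nu_faceCenter_twoFour, two_eFour]

theorem nu_faceCenter_self (k : Fin 5) (v : Vertex) :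
    nu k (hypercubeEmbedding.faceCenter k v) = hypercubeEmbedding.eTwo k := by
  rw [nu_faceCenter_two, eTwo_eq]

theorem nu_faceCenter_add_one (k : Fin 5) (v : Vertex) :
    nu k (hypercubeEmbedding.faceCenter (k + 1) v) =
      (2 : ℤ) • hypercubeEmbedding.eFour k + hypercubeEmbedding.eTwo k := by
  rw [nu_faceCenter_third, two_eFour, eTwo_eq,
    E_add_two_torsion _ _ (nonsingular_third k) (xTwoFour_ne_xTwo k) (xTwo_add_xThird k)]

theorem nu_faceCenter_sub_two (k : Fin 5) (v : Vertex) :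
    nu k (hypercubeEmbedding.faceCenter (k - 2) v) =
      vertexSign k v • hypercubeEmbedding.eFour k := by
  rw [nu_faceCenter_four, eFour_eq]

/-! ### The independence of `e^k_∞`, `e^k_4` and `e^k_2` -/

/-- At any place of `ℂ` above 2 the root of unity `ζ` is integral, hence so are `root k` and `xInf
k`. It remains to see that `xInf k ^ 2 - root k` is a unit there. -/
theorem eInf_not_isOfFinAddOrder (k : Fin 5) :
    ¬ IsOfFinAddOrder (hypercubeEmbedding.eInf k) := by
  obtain ⟨A, h2⟩ := exists_valuationSubring_two ℂ
  have h5 := zeta_five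
  have hm := zeta_min
  have hp := phi_eq
  have hz : zeta ∈ A := by
    rw [← A.valuation_le_one_iff]
    have h : A.valuation zeta ^ 10 = 1 := by
      rw [← map_pow, (zeta_pow_eq_one_iff 10).mpr dvd_rfl, map_one]
    exact ((pow_eq_one_iff_of_nonneg zero_le (by norm_num)).mp h).le
  have hφ : phi ∈ A := hp ▸ sub_mem hz (pow_mem hz 4)
  have hr : root k ∈ A := by
    fin_cases k
    · exact hφ
    · exact add_mem hφ (one_mem A)
    · exact hφ
    · exact neg_mem hφ
    · exact add_mem hφ (one_mem A)
  have hx : xInf k ∈ A := by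
    have h1 := (one_mem A)
    have hz3 := pow_mem hz 3
    have ha := add_mem h1 (pow_mem hz 2)
    have hb := sub_mem (sub_mem h1 hz) hz3
    fin_cases k
    · exact ha
    · exact hb
    · exact ha
    · exact add_mem hz hz3
    · exact hb
  -- It suffices to invert `α` modulo 2: `1 + 2 γ` is a unit, and so is any integral divisor of it.
  have hunit : ∀ α ∈ A, ∀ β ∈ A, ∀ γ ∈ A, α * β = 1 + 2 * γ → A.valuation α = 1 := by
    intro α hα β hβ γ hγ h
    have hα := (A.valuation_le_one_iff α).mpr hα
    have hβ := (A.valuation_le_one_iff β).mpr hβ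
    have hγ := (A.valuation_le_one_iff γ).mpr hγ
    have h1 : A.valuation (2 * γ) < 1 := by
      rw [map_mul]
      exact mul_lt_one_of_nonneg_of_lt_one_left zero_le h2 hγ
    have h2 := congrArg A.valuation h
    rw [Valuation.map_one_add_of_lt _ h1, map_mul] at h2
    refine hα.antisymm ?_
    rw [← h2]
    exact mul_le_of_le_one_right' hβ
  have hxr := sub_mem (pow_mem hx 2) hr
  rw [eInf_eq]
  refine not_isOfFinAddOrder_of_val h2 ((A.valuation_le_one_iff _).mpr hr) _
    ((A.valuation_le_one_iff _).mpr hx) ?_ ?_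
  · have h1 := one_mem A
    have hz2 := pow_mem hz 2
    have hz3 := pow_mem hz 3
    -- Inverses `β` modulo 2 in `ℤ[ζ]`, with the remainders `γ` that they leave.
    have hγ : -2 - zeta ^ 2 + zeta ^ 3 ∈ A :=
      add_mem (sub_mem (neg_mem (one_add_one_eq_two (R := ℂ) ▸ add_mem h1 h1)) hz2) hz3
    have hγ' : 1 - 3 * zeta - zeta ^ 2 - 4 * zeta ^ 3 ∈ A :=
      sub_mem (sub_mem (sub_mem h1 (mul_mem (ofNat_mem A 3) hz)) hz2)
        (mul_mem (ofNat_mem A 4) hz3)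
    have hβ := add_mem hz hz3
    have hβ' := add_mem (add_mem hz hz2) hz3
    fin_cases k
    · exact hunit _ hxr _ hβ _ hγ (by simp [xInf, root]; grind)
    · exact hunit _ hxr _ hβ' _ hγ' (by simp [xInf, root]; grind)
    · exact hunit _ hxr _ hβ _ hγ (by simp [xInf, root]; grind)
    · exact hunit _ hxr _ hβ' _ hγ (by simp [xInf, root]; grind)
    · exact hunit _ hxr _ hβ' _ hγ' (by simp [xInf, root]; grind)
  · have hz0 := zeta_ne_zero
    have hp0 := phi_ne_zero
    have hs : sqrtPhi ≠ 0 := fun h => phi_ne_zero (by rw [← sqrtPhi_sq, h]; norm_num)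
    fin_cases k <;> simp [yInf, hz0, hp0, hs]

theorem zsmul_independent (k : Fin 5) {a b c : ℤ}
    (h : a • hypercubeEmbedding.eInf k + b • hypercubeEmbedding.eFour k +
      c • hypercubeEmbedding.eTwo k = 0) : a = 0 ∧ 4 ∣ b ∧ 2 ∣ c :=
  eq_zero_and_dvd_of_zsmul_add_eq_zero (eInf_not_isOfFinAddOrder k) (four_eFour k)
    (two_eFour_ne_zero k) (two_eTwo k) (eTwo_ne_zero k) (two_eFour_ne_eTwo k) h

end Embedding

/-! ### Sums over the vertices and faces of the hypercube -/

/-- The corner opposite to `v` in the `(j, j+1)`-coloured 4-cycle through `v`. -/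
def opposite (j : Fin 5) (v : Vertex) : Vertex := nbr (nbr v j) (j + 1)

theorem nbr_comm (v : Vertex) (i j : Fin 5) : nbr (nbr v i) j = nbr (nbr v j) i := by
  unfold nbr
  abel

theorem nbr_opposite (j : Fin 5) (v : Vertex) : nbr (opposite j v) j = nbr v (j + 1) := by
  rw [opposite, nbr_comm, nbr_nbr]

theorem nbr_opposite' (j : Fin 5) (v : Vertex) : nbr (opposite j v) (j + 1) = nbr v j := by
  rw [opposite, nbr_nbr]

theorem opposite_opposite (j : Fin 5) (v : Vertex) : opposite j (opposite j v) = v := by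
  rw [opposite, nbr_opposite, nbr_nbr]

theorem nbr_apply_self (v : Vertex) (j : Fin 5) : nbr v j j = v j + 1 := by
  simp [nbr]

theorem nbr_apply_of_ne (v : Vertex) {i j : Fin 5} (h : i ≠ j) : nbr v j i = v i := by
  simp [nbr, h]

theorem sum_filter_eq_sum_nbr {M : Type*} [AddCommMonoid M] (p : Vertex → Prop) [DecidablePred p]
    (l : Fin 5) (hp : ∀ v, p (nbr v l) ↔ p v) (f : Vertex → M) :
    ∑ v with p v, f v = ∑ v with p v ∧ v l = 0, (f v + f (nbr v l)) := by
  have h2 : ∀ a : ZMod 2, a + 1 = 0 ↔ ¬ a = 0 := by decide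
  rw [Finset.sum_add_distrib, ← Finset.sum_filter_add_sum_filter_not _ fun v : Vertex => v l = 0,
    Finset.filter_filter, Finset.filter_filter]
  congr 1
  refine Finset.sum_nbij' (fun v => nbr v l) (fun v => nbr v l) ?_ ?_ ?_ ?_ ?_
  · intro v
    simp [hp, nbr_apply_self, h2]
  · intro v
    simp +contextual [hp, nbr_apply_self]
  · intro v _
    exact nbr_nbr v l
  · intro v _
    exact nbr_nbr v l
  · intro v _
    rw [nbr_nbr]

/-- The representatives of the `(j, j+1)`-coloured 4-cycles. -/
def faceReps (j : Fin 5) : Finset Vertex := {v | v j = 0 ∧ v (j + 1) = 0}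

theorem sum_eq_sum_faceReps {M : Type*} [AddCommMonoid M] (j : Fin 5) (f : Vertex → M) :
    ∑ v, f v =
      ∑ v ∈ faceReps j, (f v + f (nbr v j) + (f (nbr v (j + 1)) + f (opposite j v))) := by
  have h1 := sum_filter_eq_sum_nbr (fun _ => True) j (fun _ => Iff.rfl) f
  have h2 := sum_filter_eq_sum_nbr (fun v => v j = 0) (j + 1)
    (fun v => by rw [nbr_apply_of_ne v (by clear h1; revert j; decide)]) fun v => f v + f (nbr v j)
  simp only [Finset.filter_true, true_and] at h1
  rw [h1, h2]
  refine Finset.sum_congr rfl fun v _ => ?_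
  rw [opposite, nbr_comm v]

theorem card_faceReps (j : Fin 5) : (faceReps j).card = 8 := by
  have h := sum_eq_sum_faceReps j fun _ => 1
  simp only [Finset.sum_const, smul_eq_mul] at h
  rw [show (Finset.univ : Finset Vertex).card = 32 by simp [ZMod.card]] at h
  omega

theorem sum_face {M : Type*} [AddCommMonoid M] (G : Fin 5 → Vertex → M) :
    ∑ f : Face, G f.1.1 f.1.2 = ∑ j, ∑ v ∈ faceReps j, G j v := by
  rw [← Finset.sum_subtype (Finset.univ.filter fun p : Fin 5 × Vertex =>
    p.2 p.1 = 0 ∧ p.2 (p.1 + 1) = 0) (by simp) fun p => G p.1 p.2, Finset.sum_filter,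
    Fintype.sum_prod_type]
  refine Finset.sum_congr rfl fun j _ => ?_
  rw [faceReps, Finset.sum_filter]

theorem sum_fin_five {M : Type*} [AddCommMonoid M] (F : Fin 5 → M) (k : Fin 5) :
    ∑ j, F j = F (k - 2) + F (k - 1) + F k + F (k + 1) + F (k + 2) := by
  rw [← Equiv.sum_comp (Equiv.addLeft (k - 2)) F, Fin.sum_univ_five]
  have h : k - 2 + 0 = k - 2 ∧ k - 2 + 1 = k - 1 ∧ k - 2 + 2 = k ∧ k - 2 + 3 = k + 1 ∧
      k - 2 + 4 = k + 2 := by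
    revert k
    decide
  simp only [Equiv.coe_addLeft, h]

theorem sum_eq_zero_of_antisymm {f : Vertex → ℤ} {t : Vertex → Vertex}
    (ht : ∀ v, t (t v) = v) (hf : ∀ v, f (t v) = -f v) : ∑ v, f v = 0 := by
  have h : ∑ v, f (t v) = ∑ v, f v := Equiv.sum_comp (Function.Involutive.toPerm t ht) f
  simp only [hf, Finset.sum_neg_distrib] at h
  omega

theorem vertexSign_nbr (k l : Fin 5) (v : Vertex) :
    vertexSign k (nbr v l) = if l = k ∨ l = k + 2 then -vertexSign k v else vertexSign k v := by
  have h1 : ∀ a b : ZMod 2, a + 1 = b ↔ ¬ a = b := by decide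
  have h2 : ∀ a b : ZMod 2, a = b + 1 ↔ ¬ a = b := by decide
  have hk : k ≠ k + 2 := by
    revert k
    decide
  unfold vertexSign
  by_cases hl : l = k
  · subst hl
    simp only [nbr_apply_self, nbr_apply_of_ne v hk.symm, h1, true_or, if_true]
    split_ifs <;> simp_all
  · by_cases hl' : l = k + 2
    · subst hl'
      simp only [nbr_apply_self, nbr_apply_of_ne v hk, h2, or_true, if_true]
      split_ifs <;> simp_all
    · rw [nbr_apply_of_ne v (Ne.symm hl), nbr_apply_of_ne v (Ne.symm hl'),
        if_neg (c := l = k ∨ l = k + 2) (by tauto)]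

theorem paritySign_nbr (v : Vertex) (l : Fin 5) : paritySign (nbr v l) = -paritySign v := by
  have h : ∀ a : ZMod 2, a + 1 = 1 ↔ ¬ a = 1 := by decide
  unfold paritySign
  simp only [sum_nbr, h]
  split_ifs <;> simp_all

theorem paritySign_opposite (j : Fin 5) (v : Vertex) :
    paritySign (opposite j v) = paritySign v := by
  rw [opposite, paritySign_nbr, paritySign_nbr, neg_neg]

/-- Passing to the opposite corner flips the coordinates `j` and `j + 1`. Exactly one of these lies
in `{k, k + 2}`, unless `j = k - 2`, when neither does. -/
theorem vertexSign_opposite {k j : Fin 5} (h : j ≠ k - 2) (v : Vertex) :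
    vertexSign k (opposite j v) = -vertexSign k v := by
  have hj : ((j = k ∨ j = k + 2) ∧ ¬ (j + 1 = k ∨ j + 1 = k + 2)) ∨
      (¬ (j = k ∨ j = k + 2) ∧ (j + 1 = k ∨ j + 1 = k + 2)) := by
    revert k j
    decide
  rw [opposite, vertexSign_nbr, vertexSign_nbr]
  rcases hj with ⟨h1, h2⟩ | ⟨h1, h2⟩
  · rw [if_neg h2, if_pos h1]
  · rw [if_pos h2, if_neg h1]

theorem vertexSign_nbr_sub_two (k : Fin 5) (v : Vertex) :
    vertexSign k (nbr v (k - 2)) = vertexSign k v := by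
  rw [vertexSign_nbr, if_neg (by revert k; decide)]

theorem vertexSign_nbr_sub_two_add_one (k : Fin 5) (v : Vertex) :
    vertexSign k (nbr v (k - 2 + 1)) = vertexSign k v := by
  rw [vertexSign_nbr, if_neg (by revert k; decide)]

theorem sum_vertexSign (k : Fin 5) : ∑ v, vertexSign k v = 0 :=
  sum_eq_zero_of_antisymm (t := fun v => nbr v k) (fun v => nbr_nbr v k) fun v => by
    rw [vertexSign_nbr, if_pos (Or.inl rfl)]

theorem sum_vertexSign_mul_paritySign (k : Fin 5) : ∑ v, vertexSign k v * paritySign v = 0 :=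
  sum_eq_zero_of_antisymm (t := fun v => nbr v (k - 2)) (fun v => nbr_nbr v _) fun v => by
    rw [vertexSign_nbr_sub_two, paritySign_nbr, mul_neg]

theorem sum_faceReps_vertexSign (k : Fin 5) : ∑ v ∈ faceReps (k - 2), vertexSign k v = 0 := by
  have h := sum_eq_sum_faceReps (k - 2) (vertexSign k)
  simp only [sum_vertexSign, opposite, vertexSign_nbr_sub_two, vertexSign_nbr_sub_two_add_one] at h
  rw [Finset.sum_congr rfl fun v _ => show vertexSign k v + vertexSign k v +
    (vertexSign k v + vertexSign k v) = 4 * vertexSign k v by ring, ← Finset.mul_sum] at h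
  omega

/-! ### The coefficients of the Morse divisor -/

/-- Whether the neighbours of `v` along the colours `j` and `j + 1` have different heights. -/
def faceChange (h : Vertex → ℕ) (j : Fin 5) (v : Vertex) : ℤ :=
  if h (nbr v j) = h (nbr v (j + 1)) then 0 else 1

/-- Opposite corners of a 4-cycle have the same two neighbours in it. -/
theorem faceChange_opposite (h : Vertex → ℕ) (j : Fin 5) (v : Vertex) :
    faceChange h j (opposite j v) = faceChange h j v := by
  unfold faceChange
  rw [nbr_opposite, nbr_opposite']
  simp only [eq_comm]

theorem IsHeight.sub_eq {h : Vertex → ℕ} (hh : IsHeight h) (v : Vertex) (j : Fin 5) :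
    (h (nbr v j) : ℤ) - h v = 1 ∨ (h (nbr v j) : ℤ) - h v = -1 :=
  eq_or_eq_neg_of_abs_eq (hh v j)

theorem signChanges_vertex {h : Vertex → ℕ} (hh : IsHeight h) (v : Vertex) :
    (signChanges fun j : Fin 5 => (h (nbr v j) : ℚ) - (h v : ℚ) : ℤ) =
      ∑ j, faceChange h j v := by
  unfold signChanges
  rw [Finset.card_filter]
  push_cast
  refine Finset.sum_congr rfl fun j _ => ?_
  have h1 := hh.sub_eq v j
  have h2 := hh.sub_eq v (j + 1)
  have e : ((h (nbr v j) : ℚ) - (h v : ℚ)) * ((h (nbr v (j + 1)) : ℚ) - (h v : ℚ)) < 0 ↔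
      ¬ h (nbr v j) = h (nbr v (j + 1)) := by
    have c : ((h (nbr v j) : ℚ) - (h v : ℚ)) * ((h (nbr v (j + 1)) : ℚ) - (h v : ℚ)) =
        ((((h (nbr v j) : ℤ) - h v) * ((h (nbr v (j + 1)) : ℤ) - h v) : ℤ) : ℚ) := by
      push_cast
      ring
    rw [c, Int.cast_lt_zero]
    rcases h1 with h1 | h1 <;> rcases h2 with h2 | h2 <;> rw [h1, h2] <;> norm_num <;> omega
  simp only [e, faceChange]
  split_ifs <;> simp_all

/-- The integer division by 2 in `morseCoeff` must be exact. Modulo 4, twice the indicator of a sign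
change is the difference of two consecutive signs, and these differences cancel around the cycle. -/
theorem two_mul_vertexCoeff {h : Vertex → ℕ} (hh : IsHeight h) (v : Vertex) :
    2 * vertexCoeff h v = ∑ j, faceChange h j v - 2 := by
  have hd : ∀ j, ∃ t : ℤ, 2 * faceChange h j v =
      ((h (nbr v j) : ℤ) - h v) - ((h (nbr v (j + 1)) : ℤ) - h v) + 4 * t := by
    intro j
    have h1 := hh.sub_eq v j
    have h2 := hh.sub_eq v (j + 1)
    unfold faceChange
    split_ifs with he
    · exact ⟨0, by rw [he]; ring⟩
    · rcases h1 with h1 | h1 <;> rcases h2 with h2 | h2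
      · omega
      · exact ⟨0, by rw [h1, h2]; ring⟩
      · exact ⟨1, by rw [h1, h2]; ring⟩
      · omega
  choose t ht using hd
  have hs : 2 * ∑ j, faceChange h j v = 4 * ∑ j, t j := by
    have hc := Equiv.sum_comp (Equiv.addRight (1 : Fin 5)) fun j => (h (nbr v j) : ℤ) - h v
    simp only [Equiv.coe_addRight] at hc
    rw [Finset.mul_sum, Finset.sum_congr rfl fun j _ => ht j, Finset.sum_add_distrib,
      Finset.sum_sub_distrib, hc, sub_self, zero_add, Finset.mul_sum]
  have hv : vertexCoeff h v = (∑ j, faceChange h j v) / 2 - 1 := by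
    rw [← signChanges_vertex hh]
    rfl
  omega

/-- The constant `-2` disappears because the weights sum to zero. For `j ≠ i`, `faceChange` is
symmetric and `w` antisymmetric under `opposite j`. -/
theorem sum_vertexCoeff_mul {h : Vertex → ℕ} (hh : IsHeight h) {w : Vertex → ℤ}
    (h0 : ∑ v, w v = 0) {i : Fin 5} (hw : ∀ j, j ≠ i → ∀ v, w (opposite j v) = -w v) :
    2 * ∑ v, vertexCoeff h v * w v = ∑ v, faceChange h i v * w v := by
  have h1 : 2 * ∑ v, vertexCoeff h v * w v = ∑ v, ∑ j, faceChange h j v * w v := by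
    rw [Finset.mul_sum, ← sub_zero (∑ v, ∑ j, faceChange h j v * w v), ← mul_zero 2, ← h0,
      Finset.mul_sum, ← Finset.sum_sub_distrib]
    refine Finset.sum_congr rfl fun v _ => ?_
    rw [← mul_assoc, two_mul_vertexCoeff hh, ← Finset.sum_mul, sub_mul]
  rw [h1, Finset.sum_comm]
  refine Finset.sum_eq_single i (fun j _ hj => ?_) (by simp)
  refine sum_eq_zero_of_antisymm (opposite_opposite j) fun v => ?_
  rw [faceChange_opposite, hw j hj, mul_neg]

/-- In every 4-cycle, one of the two pairs of opposite corners has equal heights. -/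
theorem IsHeight.opposite_eq {h : Vertex → ℕ} (hh : IsHeight h) (j : Fin 5) (v : Vertex) :
    h (nbr v j) = h (nbr v (j + 1)) ∨ h (opposite j v) = h v := by
  have h1 := hh.sub_eq v j
  have h2 := hh.sub_eq v (j + 1)
  have h3 := hh.sub_eq (opposite j v) j
  have h4 := hh.sub_eq (opposite j v) (j + 1)
  rw [nbr_opposite] at h3
  rw [nbr_opposite'] at h4
  omega

theorem isBowTie_iff {h : Vertex → ℕ} (hh : IsHeight h) (j : Fin 5) (v : Vertex) :
    IsBowTie h j v ↔ h (nbr v j) = h (nbr v (j + 1)) ∧ h (opposite j v) = h v := by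
  have h1 := hh.sub_eq v j
  have h2 := hh.sub_eq v (j + 1)
  have h3 := hh.sub_eq (opposite j v) j
  have h4 := hh.sub_eq (opposite j v) (j + 1)
  rw [nbr_opposite] at h3
  rw [nbr_opposite'] at h4
  have hi : (Finset.univ.image fun i => h (corner j v i)) =
      {h v, h (nbr v j), h (opposite j v), h (nbr v (j + 1))} := by
    ext a
    simp [corner, Fin.exists_fin_succ, opposite, eq_comm]
  unfold IsBowTie
  rw [hi]
  generalize h v = a at *
  generalize h (nbr v j) = b at *
  generalize h (opposite j v) = c at *
  generalize h (nbr v (j + 1)) = d at *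
  constructor
  · intro hc
    by_contra hne
    rcases eq_or_ne b d with hbd | hbd
    · subst hbd
      have hac : a ≠ c := fun hac => hne ⟨rfl, hac.symm⟩
      have : ({a, b, c, b} : Finset ℕ) = {a, b, c} := by
        ext x
        simp
        tauto
      rw [this, Finset.card_eq_three.mpr ⟨a, b, c, by omega, hac, by omega, rfl⟩] at hc
      omega
    · have hac : a = c := by omega
      subst hac
      have : ({a, b, a, d} : Finset ℕ) = {a, b, d} := by
        ext x
        simp
        tauto
      rw [this, Finset.card_eq_three.mpr ⟨a, b, d, by omega, by omega, hbd, rfl⟩] at hc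
      omega
  · rintro ⟨rfl, rfl⟩
    have : ({c, b, c, b} : Finset ℕ) = {c, b} := by
      ext x
      simp
    rw [this, Finset.card_pair (by omega)]

/-- The two `faceChange` terms test the two pairs of opposite corners. Both vanish on a bow tie, and
exactly one does on a diamond. -/
theorem faceCoeff_eq {h : Vertex → ℕ} (hh : IsHeight h) (j : Fin 5) (v : Vertex) :
    faceCoeff h j v = 1 - faceChange h j v - faceChange h j (nbr v j) := by
  have e : faceChange h j (nbr v j) = if h (opposite j v) = h v then 0 else 1 := by
    unfold faceChange
    rw [nbr_nbr, ← opposite]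
    simp only [eq_comm]
  rw [e, faceChange]
  unfold faceCoeff
  split_ifs with hb h1 h2 h2 h1 h2 h2
  · have h3 := hh.sub_eq v j
    -- On a bow tie the deviations from the average are `±1/2` with alternating signs, so there are
    -- four sign changes.
    have hc : ∀ i : Fin 4, (h (corner j v i) : ℚ) - centerHeight h j v =
        (![-1, 1, -1, 1] : Fin 4 → ℚ) i * (((h (nbr v j) : ℤ) - h v : ℤ) / 2) := by
      intro i
      have h2' : h (nbr (nbr v j) (j + 1)) = h v := h2
      have hs : centerHeight h j v = ((h v : ℚ) + h (nbr v j)) / 2 := by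
        unfold centerHeight
        simp [Fin.sum_univ_four, corner, h2', ← h1]
        ring
      rw [hs]
      fin_cases i <;> simp [corner, h2', ← h1] <;> ring
    have hs : signChanges (fun i : Fin 4 => (h (corner j v i) : ℚ) - centerHeight h j v) = 4 := by
      unfold signChanges
      simp only [hc]
      rw [Finset.filter_true_of_mem]
      · simp
      · have alt : ∀ i : Fin 4, (![-1, 1, -1, 1] : Fin 4 → ℚ) i *
            (![-1, 1, -1, 1] : Fin 4 → ℚ) (i + 1) = -1 := by
          intro i
          fin_cases i <;>
            first
              | (change (-1 : ℚ) * 1 = -1; norm_num)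
              | (change (1 : ℚ) * -1 = -1; norm_num)
        intro i _
        rw [mul_mul_mul_comm, alt]
        rcases h3 with h3 | h3 <;> rw [h3] <;> norm_num
    unfold morseCoeff
    rw [hs]
    norm_num
  · exact absurd ((isBowTie_iff hh j v).mp hb).2 h2
  · exact absurd ((isBowTie_iff hh j v).mp hb).1 h1
  · exact absurd ((isBowTie_iff hh j v).mp hb).1 h1
  · exact absurd ((isBowTie_iff hh j v).mpr ⟨h1, h2⟩) hb
  · norm_num
  · norm_num
  · exact ((hh.opposite_eq j v).elim h1 h2).elim

/-- The heights on a bow tie sum to twice an odd number, and on a diamond to four times the middle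
height. The right-hand side does not depend on `j`, so neither does the parity of the number of bow
ties. -/
theorem sum_faceCoeff_modEq {h : Vertex → ℕ} (hh : IsHeight h) (j : Fin 5) :
    2 * ∑ v ∈ faceReps j, faceCoeff h j v ≡ ∑ v, (h v : ℤ) [ZMOD 4] := by
  rw [sum_eq_sum_faceReps j, Finset.mul_sum]
  refine Int.ModEq.sum fun v _ => ?_
  have h1 := hh.sub_eq v j
  have h2 := hh.sub_eq v (j + 1)
  have h3 := hh.sub_eq (opposite j v) j
  have h4 := hh.sub_eq (opposite j v) (j + 1)
  rw [nbr_opposite] at h3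
  rw [nbr_opposite'] at h4
  have e : faceChange h j (nbr v j) = if h (opposite j v) = h v then 0 else 1 := by
    unfold faceChange
    rw [nbr_nbr, ← opposite]
    simp only [eq_comm]
  rw [faceCoeff_eq hh, e, faceChange, Int.modEq_iff_dvd]
  split_ifs <;> omega

theorem sum_faceCoeff_modEq_two {h : Vertex → ℕ} (hh : IsHeight h) (i j : Fin 5) :
    2 ∣ ∑ v ∈ faceReps i, faceCoeff h i v + ∑ v ∈ faceReps j, faceCoeff h j v := by
  have h1 := (sum_faceCoeff_modEq hh i).trans (sum_faceCoeff_modEq hh j).symm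
  rw [Int.modEq_iff_dvd] at h1
  omega

/-- Opposite corners contribute equally, so grouping the vertices by faces produces a factor 2,
which cancels the one in `sum_vertexCoeff_mul`. Both weights are covered: `s = 1` for `vertexSign`
and `s = -1` for its product with `paritySign`. -/
theorem sum_vertexCoeff_mul_eq {h : Vertex → ℕ} (hh : IsHeight h) {w : Vertex → ℤ}
    (h0 : ∑ v, w v = 0) {i : Fin 5} (hw : ∀ j, j ≠ i → ∀ v, w (opposite j v) = -w v) {s : ℤ}
    (h1 : ∀ v, w (nbr v i) = s * w v) (h2 : ∀ v, w (nbr v (i + 1)) = s * w v) (hs : s * s = 1) :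
    ∑ v, vertexCoeff h v * w v = ∑ v ∈ faceReps i,
      (faceChange h i v + s * faceChange h i (nbr v i)) * w v := by
  have e := sum_vertexCoeff_mul hh h0 hw
  rw [sum_eq_sum_faceReps i fun v => faceChange h i v * w v] at e
  have e2 : ∀ v, faceChange h i v * w v + faceChange h i (nbr v i) * w (nbr v i) +
      (faceChange h i (nbr v (i + 1)) * w (nbr v (i + 1)) +
        faceChange h i (opposite i v) * w (opposite i v)) =
      2 * ((faceChange h i v + s * faceChange h i (nbr v i)) * w v) := by
    intro v
    have e3 : nbr v (i + 1) = opposite i (nbr v i) := by rw [opposite, nbr_nbr]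
    have e4 : w (opposite i v) = w v := by
      rw [opposite, h2, h1, ← mul_assoc, hs, one_mul]
    rw [h1, h2, e4, e3, faceChange_opposite, faceChange_opposite]
    ring
  rw [Finset.sum_congr rfl fun v _ => e2 v, ← Finset.mul_sum] at e
  omega

/-- With `s = 1` the corners of a face contribute the `faceChange` terms that `faceCoeff_eq`
subtracts at its center. What remains is the sum of `vertexSign` over the faces, which is zero. -/
theorem sum_vertexCoeff_add_sum_faceCoeff {h : Vertex → ℕ} (hh : IsHeight h) (k : Fin 5) :
    ∑ v, vertexCoeff h v * vertexSign k v +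
      ∑ v ∈ faceReps (k - 2), faceCoeff h (k - 2) v * vertexSign k v = 0 := by
  rw [sum_vertexCoeff_mul_eq hh (s := 1) (i := k - 2) (sum_vertexSign k)
    (fun j hj v => vertexSign_opposite hj v)
    (fun v => by rw [vertexSign_nbr_sub_two, one_mul])
    (fun v => by rw [vertexSign_nbr_sub_two_add_one, one_mul]) (by norm_num),
    ← Finset.sum_add_distrib, ← sum_faceReps_vertexSign k]
  refine Finset.sum_congr rfl fun v _ => ?_
  rw [faceCoeff_eq hh]
  ring

/-- With `s = -1` each of the eight faces contributes, up to sign, a difference of two numbers in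
`{0, 1}`. -/
theorem abs_sum_vertexCoeff_le {h : Vertex → ℕ} (hh : IsHeight h) (k : Fin 5) :
    |∑ v, vertexCoeff h v * (vertexSign k v * paritySign v)| ≤ 8 := by
  rw [sum_vertexCoeff_mul_eq hh (s := -1) (i := k - 2) (sum_vertexSign_mul_paritySign k)
    (fun j hj v => by rw [vertexSign_opposite hj, paritySign_opposite, neg_mul])
    (fun v => by rw [vertexSign_nbr_sub_two, paritySign_nbr]; ring)
    (fun v => by rw [vertexSign_nbr_sub_two_add_one, paritySign_nbr]; ring) (by norm_num)]
  refine (Finset.abs_sum_le_sum_abs _ _).trans ?_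
  rw [show (8 : ℤ) = ∑ v ∈ faceReps (k - 2), 1 by
    rw [Finset.sum_const, card_faceReps]; rfl]
  refine Finset.sum_le_sum fun v _ => ?_
  have h1 : |vertexSign k v| = 1 := by rcases vertexSign_eq k v with h | h <;> rw [h] <;> rfl
  have h2 : |paritySign v| = 1 := by rcases paritySign_eq v with h | h <;> rw [h] <;> rfl
  rw [abs_mul, abs_mul, h1, h2, mul_one, mul_one, abs_le]
  unfold faceChange
  split_ifs <;> constructor <;> norm_num

/-! ### Assembly of `ν_k(D_h)`. -/

theorem sum_zsmul_zsmul_add {ι G : Type*} [Fintype ι] [AddCommGroup G] (a b c : ι → ℤ)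
    (Q g : G) : ∑ i, a i • (b i • Q + c i • g) =
      (∑ i, a i * b i) • Q + (∑ i, a i * c i) • g := by
  simp only [smul_add, Finset.sum_add_distrib, Finset.sum_smul, mul_smul]

/-- Here `a`, `b` come from the vertices and the faces `j = k - 2`, and `p`, `q`, `r` from the faces
`j = k - 1, k, k + 1`. The total multiples of `2 Q` and of `R` are `p + r` and `q + r`, both even.
-/
theorem divisor_relation {G : Type*} [AddCommGroup G] {Q R : G} (h4 : (4 : ℤ) • Q = 0)
    (h2 : (2 : ℤ) • R = 0) {a b p q r m n : ℤ} (hF : a + b = 0) (hm : p + r = 2 * m)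
    (hn : q + r = 2 * n) (c : ℤ) (g : G) :
    a • Q + c • g + (b • Q + (p * 2) • Q + q • R + ((r * 2) • Q + r • R) + 0) = c • g := by
  obtain rfl : b = -a := by omega
  obtain rfl : p = 2 * m - r := by omega
  obtain rfl : q = 2 * n - r := by omega
  have e : a • Q + c • g + (-a • Q + ((2 * m - r) * 2) • Q + (2 * n - r) • R +
      ((r * 2) • Q + r • R) + 0) = c • g + m • (4 : ℤ) • Q + n • (2 : ℤ) • R := by
    module
  rw [e, h4, h2, smul_zero, smul_zero, add_zero, add_zero]

namespace Embedding

theorem nuDivisor_morseDivisor {h : Vertex → ℕ} (hh : IsHeight h) (k : Fin 5) :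
    hypercubeEmbedding.nuDivisor k (morseDivisor h) =
      (∑ v, vertexCoeff h v * (vertexSign k v * paritySign v)) •
        (hypercubeEmbedding.eInf k - hypercubeEmbedding.eFour k) := by
  have hD : hypercubeEmbedding.nuDivisor k (morseDivisor h) =
      ∑ v, vertexCoeff h v • nu k (hypercubeEmbedding.vertex v) +
        ∑ j, ∑ v ∈ faceReps j, faceCoeff h j v • nu k (hypercubeEmbedding.faceCenter j v) := by
    rw [← sum_face fun j v => faceCoeff h j v • nu k (hypercubeEmbedding.faceCenter j v)]
    unfold nuDivisor
    rw [Finsupp.sum_fintype _ _ fun _ => zero_zsmul _, Fintype.sum_sum_type]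
    rfl
  have hF := sum_vertexCoeff_add_sum_faceCoeff hh k
  obtain ⟨m, hm⟩ := sum_faceCoeff_modEq_two hh (k - 1) (k + 1)
  obtain ⟨n, hn⟩ := sum_faceCoeff_modEq_two hh k (k + 1)
  have h4 := four_eFour k
  have h2 := two_eTwo k
  rw [hD, sum_fin_five _ k]
  simp only [nu_vertex, nu_faceCenter_sub_two, nu_faceCenter_sub_one, nu_faceCenter_self,
    nu_faceCenter_add_one, nu_faceCenter_pole]
  rw [sum_zsmul_zsmul_add]
  simp only [smul_add, ← mul_smul, smul_zero, ← Finset.sum_smul,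
    ← Finset.sum_mul]
  exact divisor_relation h4 h2 hF hm hn _ _

end Embedding

end Adinkra

end

theorem mainTheorem4 (h : Adinkra.Vertex → ℕ) (hh : Adinkra.IsHeight h) (k : Fin 5) :
    (∃ a b c : ℤ,
      a • Adinkra.hypercubeEmbedding.eInf k + b • Adinkra.hypercubeEmbedding.eFour k +
          c • Adinkra.hypercubeEmbedding.eTwo k =
        Adinkra.hypercubeEmbedding.nuDivisor k (Adinkra.morseDivisor h)) ∧
    ∀ a b c : ℤ,
      a • Adinkra.hypercubeEmbedding.eInf k + b • Adinkra.hypercubeEmbedding.eFour k +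
          c • Adinkra.hypercubeEmbedding.eTwo k =
        Adinkra.hypercubeEmbedding.nuDivisor k (Adinkra.morseDivisor h) →
      |a| ≤ 8 ∧ b ≡ -a [ZMOD 4] ∧ c ≡ 0 [ZMOD 2] := by
  have hD := Adinkra.Embedding.nuDivisor_morseDivisor hh k
  have hb := Adinkra.abs_sum_vertexCoeff_le hh k
  generalize ∑ v, Adinkra.vertexCoeff h v *
    (Adinkra.vertexSign k v * Adinkra.paritySign v) = n at hD hb
  rw [hD]
  -- The canonical representation is `n e_∞ - n e_4`. Any other differs from it by a relation, so `a
  -- = n`, `4 ∣ b + n` and `2 ∣ c`.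
  refine ⟨⟨n, -n, 0, ?_⟩, fun a b c e => ?_⟩
  · rw [zsmul_sub, neg_zsmul, zero_zsmul, add_zero, sub_eq_add_neg]
  · have e' : (a - n) • Adinkra.hypercubeEmbedding.eInf k +
        (b + n) • Adinkra.hypercubeEmbedding.eFour k +
          c • Adinkra.hypercubeEmbedding.eTwo k = 0 := by
      rw [← sub_eq_zero] at e
      rw [← e, sub_zsmul, add_zsmul, zsmul_sub]
      abel
    obtain ⟨h1, h2, h3⟩ := Adinkra.Embedding.zsmul_independent k e'
    obtain rfl : a = n := by omega
    refine ⟨hb, ?_, ?_⟩ <;> rw [Int.modEq_iff_dvd] <;> omega
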